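/- **Setting.** Let $N,r\ge 1$ and let $d,k$ be dimensions. Agent $i\in\{1,\dots,N\}$ has a data distribution $\mathcal D_i$ and a sample loss $\mathcal F^i(W;\xi)$, $W\in\mathbb R^{d\times k}$, differentiable in $W$; let $f^i(W)=\mathbb E_{\xi\sim\mathcal D_i}[\mathcal F^i(W;\xi)]$ and $f=\frac1N\sum_i f^i$. Let $W_0\in\mathbb R^{d\times k}$ and $\eta>0$. For a frozen matrix $A_0\in\mathbb R^{r\times k}$ a loss $\varphi$ is regarded as the function $B\mapsto\varphi(W_0+\frac{\eta}{r}BA_0)$ of $B\in\mathbb R^{d\times r}$; write $\varphi(B)$ for its value and $\nabla_B$ for its gradient. All norms are Frobenius norms. *DLoRA-FA (communication in every round).* Given a mixing matrix $\Pi=(\pi_{ij})$ supported on a graph with closed neighbourhoods $Nb(i)$, a step size $\alpha>0$ and deterministic initial matrices $B^i_1$, iterate $$B^i_{t+1}=\sum_{j\in Nb(i)}\pi_{ij}B^j_t-\alpha g^i_t,\qquad g^i_t=\frac1{|\mathcal S_i|}\sum_{s\in\mathcal S_i}\nabla_B\mathcal F^i(B^i_t;\xi^{i}_{t,s}),$$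 where every sample $\xi^i_{t,s}$ has law $\mathcal D_i$ and the mini-batches are independent over $t$ and $i$, and independent of $A_0$. Put $\bar B_t=\frac1N\sum_iB^i_t$. *Assumptions on the losses and on $\Pi$.* (1) Each $f^i$ is differentiable and $\|\nabla f^i(W)-\nabla f^i(W')\|\le L\|W-W'\|$ for all $W,W'$, where $L>0$. (2) $\Pi$ is symmetric and doubly stochastic with $\lambda_1(\Pi)=1$ and $|\lambda_l(\Pi)|\le\sqrt\rho$ for $2\le l\le N$, where $0<\rho<1$. *Assumptions for the frozen $A_0$.* (3) $f^*:=\inf_Bf(B)>-\infty$. (4) For some $\zeta,\kappa>0$ and all $B$ and $i$: $\mathbb E_{\xi\sim\mathcal D_i}\nabla_B\mathcal F^i(B;\xi)=\nabla_Bf^i(B)$, $\ \mathbb E_{\xi\sim\mathcal D_i}\|\nabla_B\mathcal F^i(B;\xi)-\nabla_Bf^i(B)\|^2\le\zeta^2$, and $\frac1N\sum_i\|\nabla_Bf^i(B)-\nabla_Bf(B)\|^2\le\kappa^2$. For $\Lambda>0$ say that $A_0$ *is good for $\Lambda$* if, whenever (3) and (4) hold for $A_0$ with constants $\zeta,\kappa$,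 then for every $0<\alpha\le\frac{1-\sqrt\rho}{4\sqrt2\,\Lambda}$, every initialization and every $T\ge1$, the expectations below (over the mini-batches, with $A_0$ fixed) are finite and $$\frac1T\sum_{t=1}^T\mathbb E\|\nabla_Bf(\bar B_t)\|^2\le\frac{2D}{\alpha T}+\frac{\Lambda\alpha\zeta^2}{N}+\frac{\Lambda^2\sum_{i=1}^N\|B_1^i\|^2}{TN(1-\rho)}+\frac{16\alpha^2\kappa^2\Lambda^2}{(1-\sqrt\rho)^2}+\frac{4\alpha^2\zeta^2\Lambda^2}{1-\rho},\qquad D=f(\bar B_1)-f^*.$$ **Theorem.** Assume (1) and (2), and let $A_0$ be drawn with independent $\mathcal N(0,1)$ entries. (a) Let $\tilde L=\eta^2L\bigl(1+\frac kr+2\frac{\sqrt k}{r^{1.5}}\bigr)$. Every $A_0$ with $\|A_0\|_F^2\le r^2+kr+2\sqrt{kr}$ is good for $\tilde L$, and this event has probability at least $1-\exp\bigl(-\tfrac12\bigl(\sqrt{r^2+kr+2\sqrt{kr}}-\sqrt{kr}\bigr)^2\bigr)$, which is at least $1-e^{-1/2}$. (b) Let $\tilde L'=\eta^2L\bigl(1+\frac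 kr+2\sqrt{\frac kr}\bigr)=\frac{\eta^2L}{r^2}(r+\sqrt{kr})^2$. Every $A_0$ with $\|A_0\|_F\le r+\sqrt{kr}$ is good for $\tilde L'$, and this event has probability at least $1-e^{-r^2/2}$. -/

import Mathlib

open MeasureTheory ProbabilityTheory

noncomputable section

namespace DLoRA

/-- Real `m × n` matrices, flattened, so that `‖·‖` is the Frobenius norm and the inner
product is the Frobenius inner product. -/
abbrev Mat (m n : ℕ) := EuclideanSpace ℝ (Fin m × Fin n)

/-- The matrix product `B A`. -/
def matMul {d r k : ℕ} (B : Mat d r) (A : Mat r k) : Mat d k :=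
  WithLp.toLp 2 fun p => ∑ l, B (p.1, l) * A (l, p.2)

/-- The model parameter `W₀ + (η / r) B A₀` with frozen `W₀` and `A₀`. -/
def adapted {d r k : ℕ} (η : ℝ) (W₀ : Mat d k) (A₀ : Mat r k) (B : Mat d r) : Mat d k :=
  W₀ + (η / (r : ℝ)) • matMul B A₀

/-- The loss `φ` as a function of the trainable matrix `B`. -/
def lossB {d r k : ℕ} (η : ℝ) (W₀ : Mat d k) (A₀ : Mat r k) (φ : Mat d k → ℝ) (B : Mat d r) : ℝ :=
  φ (adapted η W₀ A₀ B)

/-- The gradient of the loss `φ` with respect to the trainable matrix `B`. -/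
def gradB {d r k : ℕ} (η : ℝ) (W₀ : Mat d k) (A₀ : Mat r k) (φ : Mat d k → ℝ) (B : Mat d r) :
    Mat d r :=
  gradient (lossB η W₀ A₀ φ) B

/-- The loss of one agent: the expected sample loss under its data distribution. -/
def localLoss {d k : ℕ} {X : Type*} [MeasurableSpace X] (𝒟 : Measure X) (F : Mat d k → X → ℝ)
    (W : Mat d k) : ℝ :=
  ∫ x, F W x ∂𝒟

/-- The average of the local losses. -/
def globalLoss {d k N : ℕ} {X : Fin N → Type*} [∀ i, MeasurableSpace (X i)]
    (𝒟 : ∀ i, Measure (X i)) (F : ∀ i, Mat d k → X i → ℝ) (W : Mat d k) : ℝ :=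
  (N : ℝ)⁻¹ * ∑ i, localLoss (𝒟 i) (F i) W

/-- The average of the adapters of all agents. -/
def average {d r N : ℕ} (B : Fin N → Mat d r) : Mat d r := (N : ℝ)⁻¹ • ∑ i, B i

/-- Symmetric doubly stochastic mixing matrices on the graph `G` with largest eigenvalue `1`
and all other eigenvalues of modulus at most `√ρ`; `eigenvalues₀` lists the eigenvalues,
with multiplicity, in decreasing order. -/
structure IsMixingMatrix {N : ℕ} (G : SimpleGraph (Fin N)) (M : Matrix (Fin N) (Fin N) ℝ)
    (ρ : ℝ) : Prop where
  isHermitian : M.IsHermitian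
  doublyStochastic : M ∈ doublyStochastic ℝ (Fin N)
  support : ∀ i j, i ≠ j → ¬ G.Adj i j → M i j = 0
  eigenvalue_first : ∀ l : Fin (Fintype.card (Fin N)), (l : ℕ) = 0 → isHermitian.eigenvalues₀ l = 1
  eigenvalue_other : ∀ l : Fin (Fintype.card (Fin N)), (l : ℕ) ≠ 0 → |isHermitian.eigenvalues₀ l| ≤ √ρ

/-- The mini-batch stochastic gradient of one agent with respect to `B`. -/
def stochGrad {d r k m : ℕ} {X : Type*} (η : ℝ) (W₀ : Mat d k) (A₀ : Mat r k)
    (F : Mat d k → X → ℝ) (batch : Fin m → X) (B : Mat d r) : Mat d r :=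
  (m : ℝ)⁻¹ • ∑ s, gradB η W₀ A₀ (fun W => F W (batch s)) B

open Classical in
/-- DLoRA-FA with communication in every round: `iterate … B₁ batch n i` is the matrix of
agent `i` after `n` rounds, that is `B^i_{n+1}` when the initialization is called `B^i_1`;
`batch n i` is the mini-batch that agent `i` draws in round `n + 1`. -/
def iterate {d r k N : ℕ} {m : Fin N → ℕ} {X : Fin N → Type*} (η α : ℝ) (W₀ : Mat d k)
    (A₀ : Mat r k) (F : ∀ i, Mat d k → X i → ℝ) (G : SimpleGraph (Fin N))
    (M : Matrix (Fin N) (Fin N) ℝ) (B₁ : Fin N → Mat d r)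
    (batch : ℕ → ∀ i, Fin (m i) → X i) : ℕ → Fin N → Mat d r
  | 0 => B₁
  | n + 1 => fun i =>
      (∑ j with j = i ∨ G.Adj i j,
          M i j • iterate η α W₀ A₀ F G M B₁ batch n j)
        - α • stochGrad η W₀ A₀ (F i) (batch n i)
            (iterate η α W₀ A₀ F G M B₁ batch n i)

/-- The assumptions on the stochastic gradients and on the objective once `A₀` is frozen. -/
structure FrozenAssumptions {d r k N : ℕ} {X : Fin N → Type*} [∀ i, MeasurableSpace (X i)]
    (η : ℝ) (W₀ : Mat d k) (A₀ : Mat r k) (𝒟 : ∀ i, Measure (X i))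
    (F : ∀ i, Mat d k → X i → ℝ) (ζ κ : ℝ) : Prop where
  bddBelow : BddBelow (Set.range (lossB (r := r) η W₀ A₀ (globalLoss 𝒟 F)))
  unbiased : ∀ i (B : Mat d r),
    ∫ x, gradB η W₀ A₀ (fun W => F i W x) B ∂𝒟 i = gradB η W₀ A₀ (localLoss (𝒟 i) (F i)) B
  integrable_variance : ∀ i (B : Mat d r), Integrable (fun x =>
    ‖gradB η W₀ A₀ (fun W => F i W x) B - gradB η W₀ A₀ (localLoss (𝒟 i) (F i)) B‖ ^ 2) (𝒟 i)
  variance : ∀ i (B : Mat d r),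
    ∫ x, ‖gradB η W₀ A₀ (fun W => F i W x) B
      - gradB η W₀ A₀ (localLoss (𝒟 i) (F i)) B‖ ^ 2 ∂𝒟 i ≤ ζ ^ 2
  diversity : ∀ B : Mat d r,
    (N : ℝ)⁻¹ * ∑ i, ‖gradB η W₀ A₀ (localLoss (𝒟 i) (F i)) B
      - gradB η W₀ A₀ (globalLoss 𝒟 F) B‖ ^ 2 ≤ κ ^ 2

/-- The convergence bound for DLoRA-FA with frozen `A₀` and smoothness constant `Ls`, for every
admissible step size, initialization and horizon. The first `T` iterates are those numbered
`1, …, T` when the initialization has number `1`. -/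
def ConvergesWith {d r k N : ℕ} {m : Fin N → ℕ} {X : Fin N → Type*} [∀ i, MeasurableSpace (X i)]
    {Ω : Type*} [MeasurableSpace Ω] (P : Measure Ω) (η : ℝ) (W₀ : Mat d k)
    (𝒟 : ∀ i, Measure (X i)) (F : ∀ i, Mat d k → X i → ℝ) (G : SimpleGraph (Fin N))
    (M : Matrix (Fin N) (Fin N) ℝ) (ρ : ℝ) (batch : Ω → ℕ → ∀ i, Fin (m i) → X i)
    (A₀ : Mat r k) (Ls : ℝ) : Prop :=
  ∀ ζ κ : ℝ, 0 < ζ → 0 < κ → FrozenAssumptions η W₀ A₀ 𝒟 F ζ κ →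
  ∀ α : ℝ, 0 < α → α ≤ (1 - √ρ) / (4 * √2 * Ls) →
  ∀ B₁ : Fin N → Mat d r,
    (∀ n, Integrable (fun ω => ‖gradB η W₀ A₀ (globalLoss 𝒟 F)
      (average (iterate η α W₀ A₀ F G M B₁ (batch ω) n))‖ ^ 2) P) ∧
    ∀ T : ℕ, 1 ≤ T →
      (T : ℝ)⁻¹ * ∑ n ∈ Finset.range T, ∫ ω, ‖gradB η W₀ A₀ (globalLoss 𝒟 F)
          (average (iterate η α W₀ A₀ F G M B₁ (batch ω) n))‖ ^ 2 ∂P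
        ≤ 2 * (lossB η W₀ A₀ (globalLoss 𝒟 F) (average B₁)
              - ⨅ B : Mat d r, lossB η W₀ A₀ (globalLoss 𝒟 F) B) / (α * T)
          + Ls * α * ζ ^ 2 / N
          + Ls ^ 2 * (∑ i, ‖B₁ i‖ ^ 2) / (T * N * (1 - ρ))
          + 16 * α ^ 2 * κ ^ 2 * Ls ^ 2 / (1 - √ρ) ^ 2
          + 4 * α ^ 2 * ζ ^ 2 * Ls ^ 2 / (1 - ρ)

/-- The law of an `r × k` matrix with independent standard normal entries. -/
def gaussianMatrix (r k : ℕ) : Measure (Mat r k) :=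
  (Measure.pi fun _ : Fin r × Fin k => gaussianReal 0 1).map (WithLp.toLp 2)

end DLoRA

end

/-! ### Functions with Lipschitz gradient -/

section Smooth

variable {V : Type*} [NormedAddCommGroup V] [InnerProductSpace ℝ V] [CompleteSpace V]

/-! Freezing `A₀` composes every loss with an affine map whose linear part `adapterMap` has operator
norm at most `η / r * ‖A₀‖`. By the chain rule this norm enters the Lipschitz constant of the
gradient twice (`norm_gradB_sub_le`), so each bound on `‖A₀‖` gives smoothness in `B` with the
claimed constant. It remains to analyse decentralized SGD for smooth losses and to bound the tail of
`‖A₀‖`.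

For SGD (`decentralized_sgd_bound`) two recursions in expectation are coupled. The mean of the
agents follows the averaged stochastic gradient, so the objective descends (`expected_descent`) up
to an error controlled by the consensus error; the noise is uncorrelated between agents, which gives
the variance `ζ² / N`. The deviations from the mean are contracted by the spectral gap
(`sum_norm_sq_le`), up to gradient differences, heterogeneity and noise (`consensus_step_le`). The
noise terms linear in the noise vanish because a state depends only on earlier batches, hence is
independent of the current one (`noise_orthogonal`).

The two recursions are added with weights. Constant weights would charge more than `1 / (1 - ρ)` for
the initial consensus error, so `sum_le_of_lyapunov` lets the weights relax geometrically: the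
weight of the objective gap falls from 1 towards 3/4, that of the consensus error rises. The fall of
the first weight pays for part of the gradient term through `‖∇f‖² ≤ 2Λ (f - c)`.

The tail of `‖A₀‖` is a Chernoff bound with the exact moment generating function of the squared norm
(`gaussian_norm_tail`). -/

/-- The quadratic upper bound of a function with Lipschitz gradient. -/
theorem le_quadratic_of_lipschitz_gradient {f : V → ℝ} {g : V → V} {Λ : ℝ}
    (hf : ∀ x, HasGradientAt f (g x) x) (hg : ∀ x y, ‖g x - g y‖ ≤ Λ * ‖x - y‖) (x v : V) :
    f (x + v) ≤ f x + inner ℝ (g x) v + Λ / 2 * ‖v‖ ^ 2 := by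
  have hline : ∀ t : ℝ, HasDerivAt (fun t : ℝ => f (x + t • v)) (inner ℝ (g (x + t • v)) v) t := by
    intro t
    have h1 : HasDerivAt (fun t : ℝ => x + t • v) v t := by
      simpa using ((hasDerivAt_id t).smul_const v).const_add x
    have h2 := (hf (x + t • v)).hasFDerivAt.comp_hasDerivAt t h1
    simpa [Function.comp_def] using h2
  -- Along the segment, subtracting the linear and quadratic terms leaves a function with
  -- nonpositive derivative; comparing its values at 0 and 1 is the claim.
  have hφ : ∀ t : ℝ, HasDerivAt
      (fun t : ℝ => f (x + t • v) - t * inner ℝ (g x) v - Λ / 2 * ‖v‖ ^ 2 * t ^ 2)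
      (inner ℝ (g (x + t • v)) v - inner ℝ (g x) v - Λ / 2 * ‖v‖ ^ 2 * (2 * t)) t := by
    intro t
    have h1 := (hasDerivAt_id t).mul_const (inner ℝ (g x) v)
    have h2 := ((hasDerivAt_id t).pow 2).const_mul (Λ / 2 * ‖v‖ ^ 2)
    simpa using ((hline t).fun_sub h1).fun_sub h2
  have hanti : AntitoneOn
      (fun t : ℝ => f (x + t • v) - t * inner ℝ (g x) v - Λ / 2 * ‖v‖ ^ 2 * t ^ 2)
      (Set.Icc 0 1) := by
    refine antitoneOn_of_deriv_nonpos (convex_Icc 0 1)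
      (fun t _ => (hφ t).continuousAt.continuousWithinAt)
      (fun t _ => (hφ t).differentiableAt.differentiableWithinAt) fun t ht => ?_
    rw [interior_Icc] at ht
    rw [(hφ t).deriv, ← inner_sub_left]
    have h1 := real_inner_le_norm (g (x + t • v) - g x) v
    have h2 := hg (x + t • v) x
    rw [add_sub_cancel_left, norm_smul, Real.norm_eq_abs, abs_of_pos ht.1] at h2
    nlinarith [mul_le_mul_of_nonneg_right h2 (norm_nonneg v)]
  have := hanti (Set.left_mem_Icc.2 zero_le_one) (Set.right_mem_Icc.2 zero_le_one) zero_le_one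
  simp at this
  linarith

/-- A function with Lipschitz gradient bounded below by `c` satisfies `‖∇f‖² ≤ 2Λ (f - c)`. -/
theorem norm_gradient_sq_le {f : V → ℝ} {g : V → V} {Λ c : ℝ} (hΛ : 0 < Λ)
    (hf : ∀ x, HasGradientAt f (g x) x) (hg : ∀ x y, ‖g x - g y‖ ≤ Λ * ‖x - y‖)
    (hc : ∀ x, c ≤ f x) (x : V) : ‖g x‖ ^ 2 ≤ 2 * Λ * (f x - c) := by
  -- One gradient step of length `1 / Λ` minimizes the quadratic upper bound, and the value reached
  -- is still at least `c`.
  have h := le_quadratic_of_lipschitz_gradient hf hg x (-Λ⁻¹ • g x)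
  have h2 := hc (x + -Λ⁻¹ • g x)
  rw [inner_smul_right, real_inner_self_eq_norm_sq, norm_smul, mul_pow, Real.norm_eq_abs,
    sq_abs] at h
  have h3 : Λ / 2 * ((-Λ⁻¹) ^ 2 * ‖g x‖ ^ 2) = Λ⁻¹ / 2 * ‖g x‖ ^ 2 := by field_simp
  rw [h3] at h
  have h4 : Λ⁻¹ / 2 * ‖g x‖ ^ 2 ≤ f x - c := by linarith
  calc ‖g x‖ ^ 2 = 2 * Λ * (Λ⁻¹ / 2 * ‖g x‖ ^ 2) := by field_simp
    _ ≤ _ := by gcongr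

end Smooth

/-! ### Spectral gap of the mixing matrix -/

section Spectral

open Matrix in
/-- A mixing matrix contracts real vectors of zero sum. -/
theorem DLoRA.IsMixingMatrix.sum_sq_mulVec_le {N : ℕ} {G : SimpleGraph (Fin N)}
    {M : Matrix (Fin N) (Fin N) ℝ} {ρ : ℝ} (hM : DLoRA.IsMixingMatrix G M ρ) (hN : 0 < N)
    (hρ0 : 0 ≤ ρ) (hρ1 : ρ < 1) (v : Fin N → ℝ) (hv : ∑ i, v i = 0) :
    ∑ i, (∑ j, M i j * v j) ^ 2 ≤ ρ * ∑ i, v i ^ 2 := by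
  set b := hM.isHermitian.eigenvectorBasis with hb
  set lam := hM.isHermitian.eigenvalues with hlam
  -- This is the enumeration inside the definition of `eigenvalues`, so `lam i` unfolds to
  -- `eigenvalues₀ (e i)`.
  let e : Fin N ≃ Fin (Fintype.card (Fin N)) :=
    (Fintype.equivOfCardEq (Fintype.card_fin (Fintype.card (Fin N)))).symm
  have hcard : 0 < Fintype.card (Fin N) := by simpa using hN
  let i₀ : Fin N := e.symm ⟨0, hcard⟩
  have hother : ∀ i, i ≠ i₀ → |lam i| ≤ √ρ := by
    intro i hi
    refine hM.eigenvalue_other (e i) fun h => hi ?_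
    rw [Equiv.eq_symm_apply]
    exact Fin.ext h
  have hs1 : √ρ < 1 := by rw [Real.sqrt_lt' one_pos]; simpa using hρ1
  -- inner products of a vector with an eigenvector
  have hinner : ∀ (w : Fin N → ℝ) i,
      inner ℝ (b i) (WithLp.toLp 2 (M *ᵥ w)) = lam i * inner ℝ (b i) (WithLp.toLp 2 w) := by
    intro w i
    have h1 := hM.isHermitian.mulVec_eigenvectorBasis i
    have hT : Mᵀ = M := by simpa using hM.isHermitian.eq
    rw [EuclideanSpace.inner_eq_star_dotProduct, EuclideanSpace.inner_eq_star_dotProduct]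
    simp only [star_trivial]
    rw [← hb, ← hlam] at h1
    have h2 : (M *ᵥ w) ⬝ᵥ (b i).ofLp = w ⬝ᵥ (M *ᵥ (b i).ofLp) := by
      rw [Matrix.dotProduct_mulVec, ← Matrix.mulVec_transpose, hT]
    rw [h2, h1, dotProduct_smul, smul_eq_mul]
  set one : EuclideanSpace ℝ (Fin N) := WithLp.toLp 2 1 with hone
  -- The vector of ones is fixed by `M`, so it is orthogonal to eigenvectors with eigenvalue below
  -- 1. Hence it is a multiple of `b i₀`, and zero-sum vectors have no `b i₀` component.
  have hone_inner : ∀ i, i ≠ i₀ → inner ℝ (b i) one = 0 := by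
    intro i hi
    have h := hinner 1 i
    rw [mulVec_one_of_mem_doublyStochastic hM.doublyStochastic, ← hone] at h
    have h1 : (1 - lam i) * inner ℝ (b i) one = 0 := by linarith
    refine (mul_eq_zero.1 h1).resolve_left ?_
    have := (le_abs_self _).trans (hother i hi)
    linarith
  have hone_eq : one = inner ℝ (b i₀) one • b i₀ := by
    conv_lhs => rw [← b.sum_repr' one]
    refine Finset.sum_eq_single i₀ (fun i _ hi => ?_) (by simp)
    rw [hone_inner i hi, zero_smul]
  set x : EuclideanSpace ℝ (Fin N) := WithLp.toLp 2 v with hx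
  have honex : inner ℝ one x = 0 := by
    rw [EuclideanSpace.inner_eq_star_dotProduct]
    simpa [hone, hx, dotProduct_one] using hv
  have hone_ne : inner ℝ (b i₀) one ≠ 0 := by
    intro h
    rw [h, zero_smul] at hone_eq
    have := congrArg (fun z : EuclideanSpace ℝ (Fin N) => z ⟨0, hN⟩) hone_eq
    simp [hone] at this
  have hx0 : inner ℝ (b i₀) x = 0 := by
    rw [hone_eq, real_inner_smul_left] at honex
    exact (mul_eq_zero.1 honex).resolve_left hone_ne
  have hnorm : ∀ w : Fin N → ℝ, ∑ i, w i ^ 2 = ‖(WithLp.toLp 2 w : EuclideanSpace ℝ (Fin N))‖ ^ 2 := by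
    intro w
    simp [EuclideanSpace.norm_sq_eq]
  have h1 := hnorm (M *ᵥ v)
  simp only [Matrix.mulVec, dotProduct] at h1
  rw [h1, hnorm v, ← b.sum_sq_norm_inner_right, ← b.sum_sq_norm_inner_right, Finset.mul_sum]
  refine Finset.sum_le_sum fun i _ => ?_
  have h2 := hinner v i
  rw [h2, norm_mul, mul_pow]
  by_cases hi : i = i₀
  · rw [hi, ← hx, hx0]; simp
  · gcongr
    rw [Real.norm_eq_abs, ← Real.sq_sqrt hρ0]
    gcongr
    exact hother i hi

/-- A mixing matrix contracts families of vectors of zero sum. -/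
theorem DLoRA.IsMixingMatrix.sum_norm_sq_le {N : ℕ} {G : SimpleGraph (Fin N)}
    {M : Matrix (Fin N) (Fin N) ℝ} {ρ : ℝ} (hM : DLoRA.IsMixingMatrix G M ρ) (hN : 0 < N)
    (hρ0 : 0 ≤ ρ) (hρ1 : ρ < 1) {ι : Type*} [Fintype ι] (Y : Fin N → EuclideanSpace ℝ ι)
    (hY : ∑ i, Y i = 0) :
    ∑ i, ‖∑ j, M i j • Y j‖ ^ 2 ≤ ρ * ∑ i, ‖Y i‖ ^ 2 := by
  simp only [EuclideanSpace.norm_sq_eq, Real.norm_eq_abs, sq_abs]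
  rw [Finset.sum_comm, Finset.sum_comm (f := fun i c => (Y i).ofLp c ^ 2), Finset.mul_sum]
  refine Finset.sum_le_sum fun c _ => ?_
  have := hM.sum_sq_mulVec_le hN hρ0 hρ1 (fun i => Y i c) ?_
  · simpa using this
  · simpa using congrArg (fun z : EuclideanSpace ℝ ι => z c) hY

end Spectral

/-! ### Deterministic one-step inequalities and the Lyapunov sum -/

section Algebra

variable {V : Type*} [NormedAddCommGroup V] [InnerProductSpace ℝ V]

/-- The trade-off between the descent term and the consensus error, with weight `ω`. -/
theorem descent_quadratic_le (G m : V) {s β ω : ℝ} (hs0 : 0 ≤ s) (hs1 : s ≤ 1) (hβ0 : 0 ≤ β)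
    (hβ : β ≤ 9 / 50 * (1 - s)) (hω0 : 0 ≤ ω) (hω1 : ω ≤ 1) :
    (3 / 4 + s * ω / 4) * (-2 * inner ℝ G (G + m) + β * ‖G + m‖ ^ 2) + (1 - 7 / 5 * ω) * ‖G‖ ^ 2
      ≤ ((1 - ω) * (9 / 8 + (1 - s) / 20) + ω * (21 / 50 + 7 / 100 * (1 - s))) * ‖m‖ ^ 2 := by
  -- Every quadratic form below is made nonnegative by one such square, with `l` half the ratio of
  -- the `x` to the `a` coefficient.
  have key : ∀ l : ℝ, 0 ≤ ‖G‖ ^ 2 + 2 * l * inner ℝ G m + l ^ 2 * ‖m‖ ^ 2 := by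
    intro l
    have := sq_nonneg ‖G + l • m‖
    rw [norm_add_sq_real, inner_smul_right, norm_smul, mul_pow, Real.norm_eq_abs, sq_abs] at this
    linarith
  rw [inner_add_right, real_inner_self_eq_norm_sq, norm_add_sq_real]
  have hb := sq_nonneg ‖m‖
  generalize ‖G‖ ^ 2 = a at *
  generalize ‖m‖ ^ 2 = b at *
  generalize inner ℝ G m = x at *
  obtain ⟨δ, rfl⟩ : ∃ δ, s = 1 - δ := ⟨1 - s, by ring⟩
  obtain ⟨γ, rfl⟩ : ∃ γ, β = 9 / 50 * γ := ⟨50 / 9 * β, by ring⟩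
  have hγ0 : 0 ≤ γ := by linarith
  have hγδ : 0 ≤ δ - γ := by linarith
  have hδ1 : 0 ≤ 1 - δ := by linarith
  have hδ0 : 0 ≤ δ := by linarith
  have hω : 0 ≤ 1 - ω := by linarith
  -- The difference of the two sides is the mixture of `h0`, `h1`, `h2` with weights `1 - ω`, `ω (1
  -- - δ)`, `ω δ`. Each of these is affine on the triangle `0 ≤ γ ≤ δ ≤ 1`, so it suffices to check
  -- the vertices `(δ, γ) = (0,0), (1,0), (1,1)`, which are `e1`, `e2`, `e3`.
  have h0 : 0 ≤ (1 / 2 - 27 / 200 * γ) * a + (3 / 2 - 27 / 100 * γ) * x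
      + (9 / 8 + δ / 20 - 27 / 200 * γ) * b := by
    have e1 : 0 ≤ 1 / 2 * a + 3 / 2 * x + 9 / 8 * b := by linarith [key (3 / 2)]
    have e2 : 0 ≤ 1 / 2 * a + 3 / 2 * x + 47 / 40 * b := by linarith
    have e3 : 0 ≤ 73 / 200 * a + 123 / 100 * x + 26 / 25 * b := by
      linarith [key (123 / 73)]
    linarith [mul_nonneg hδ1 e1, mul_nonneg hγδ e2, mul_nonneg hγ0 e3]
  have h1 : 0 ≤ (12 / 5 - 9 / 50 * γ) * a + 2 * (1 - 9 / 50 * γ) * x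
      + (21 / 50 + 7 / 100 * δ - 9 / 50 * γ) * b := by
    have e1 : 0 ≤ 12 / 5 * a + 2 * x + 21 / 50 * b := by linarith [key (5 / 12)]
    have e2 : 0 ≤ 12 / 5 * a + 2 * x + 49 / 100 * b := by linarith
    have e3 : 0 ≤ 111 / 50 * a + 41 / 25 * x + 31 / 100 * b := by linarith [key (41 / 111)]
    linarith [mul_nonneg hδ1 e1, mul_nonneg hγδ e2, mul_nonneg hγ0 e3]
  have h2 : 0 ≤ (19 / 10 - 27 / 200 * γ) * a + 3 / 2 * (1 - 9 / 50 * γ) * x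
      + (21 / 50 + 7 / 100 * δ - 27 / 200 * γ) * b := by
    have e1 : 0 ≤ 19 / 10 * a + 3 / 2 * x + 21 / 50 * b := by linarith [key (15 / 38)]
    have e2 : 0 ≤ 19 / 10 * a + 3 / 2 * x + 49 / 100 * b := by linarith
    have e3 : 0 ≤ 353 / 200 * a + 123 / 100 * x + 71 / 200 * b := by linarith [key (123 / 353)]
    linarith [mul_nonneg hδ1 e1, mul_nonneg hγδ e2, mul_nonneg hγ0 e3]
  linarith [mul_nonneg hω h0, mul_nonneg (mul_nonneg hω0 hδ1) h1,
    mul_nonneg (mul_nonneg hω0 hδ0) h2]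

theorem norm_add_sq_le_young (x y : V) {c : ℝ} (hc : 0 < c) :
    ‖x + y‖ ^ 2 ≤ (1 + c) * ‖x‖ ^ 2 + (1 + 1 / c) * ‖y‖ ^ 2 := by
  have h := sq_nonneg ‖c • x - y‖
  rw [norm_sub_sq_real, real_inner_smul_left, norm_smul, mul_pow, Real.norm_eq_abs, sq_abs] at h
  rw [norm_add_sq_real]
  have h2 : 2 * inner ℝ x y ≤ c * ‖x‖ ^ 2 + 1 / c * ‖y‖ ^ 2 := by
    rw [← sub_nonneg]
    have : c * ‖x‖ ^ 2 + 1 / c * ‖y‖ ^ 2 - 2 * inner ℝ x y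
        = 1 / c * (c ^ 2 * ‖x‖ ^ 2 - 2 * (c * inner ℝ x y) + ‖y‖ ^ 2) := by
      field_simp
      ring
    rw [this]
    positivity
  linarith

theorem sum_norm_add_sq_le_young {N : ℕ} (x y : Fin N → V) {c : ℝ} (hc : 0 < c) :
    ∑ i, ‖x i + y i‖ ^ 2 ≤ (1 + c) * ∑ i, ‖x i‖ ^ 2 + (1 + 1 / c) * ∑ i, ‖y i‖ ^ 2 := by
  rw [Finset.mul_sum, Finset.mul_sum, ← Finset.sum_add_distrib]
  exact Finset.sum_le_sum fun i _ => norm_add_sq_le_young _ _ hc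

/-- The mean of a family of vectors. -/
noncomputable def vmean {V : Type*} [AddCommGroup V] [Module ℝ V] {N : ℕ} (x : Fin N → V) : V :=
  (N : ℝ)⁻¹ • ∑ i, x i

theorem sum_eq_smul_vmean {N : ℕ} (hN : 0 < N) (x : Fin N → V) :
    ∑ i, x i = (N : ℝ) • vmean x := by
  rw [vmean, smul_inv_smul₀ (by positivity)]

theorem sum_sub_vmean {N : ℕ} (hN : 0 < N) (x : Fin N → V) : ∑ i, (x i - vmean x) = 0 := by
  rw [Finset.sum_sub_distrib, sum_eq_smul_vmean hN]
  simp [← Nat.cast_smul_eq_nsmul ℝ]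

/-- The bias–variance identity. Dropping either nonnegative term gives that centring does not
increase the sum of squares, and Jensen's inequality for the mean. -/
theorem sum_norm_sub_vmean_sq {N : ℕ} (hN : 0 < N) (x : Fin N → V) :
    ∑ i, ‖x i - vmean x‖ ^ 2 = ∑ i, ‖x i‖ ^ 2 - N * ‖vmean x‖ ^ 2 := by
  simp_rw [norm_sub_sq_real]
  rw [Finset.sum_add_distrib, Finset.sum_sub_distrib, ← Finset.mul_sum, ← sum_inner,
    sum_eq_smul_vmean hN x, real_inner_smul_left, real_inner_self_eq_norm_sq]
  simp
  ring

theorem sum_norm_sub_vmean_sq_le {N : ℕ} (hN : 0 < N) (x : Fin N → V) :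
    ∑ i, ‖x i - vmean x‖ ^ 2 ≤ ∑ i, ‖x i‖ ^ 2 := by
  rw [sum_norm_sub_vmean_sq hN]
  have : 0 ≤ N * ‖vmean x‖ ^ 2 := by positivity
  linarith

theorem norm_vmean_sq_le {N : ℕ} (hN : 0 < N) (x : Fin N → V) :
    ‖vmean x‖ ^ 2 ≤ (N : ℝ)⁻¹ * ∑ i, ‖x i‖ ^ 2 := by
  have h : 0 ≤ ∑ i, ‖x i - vmean x‖ ^ 2 := by positivity
  rw [sum_norm_sub_vmean_sq hN] at h
  rw [inv_mul_eq_div, le_div_iff₀ (by positivity)]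
  linarith

/-- The contraction of the consensus error in one noiseless step. -/
theorem consensus_step_le {N : ℕ} (hN : 0 < N) {M : Matrix (Fin N) (Fin N) ℝ} {s α Λ : ℝ}
    (hs0 : 0 < s) (hs1 : s < 1) (hα : 0 ≤ α) (hαΛ : α * Λ ≤ 9 / 50 * (1 - s)) (hΛ : 0 ≤ Λ)
    (Y d k : Fin N → V)
    (hmix : ∑ i, ‖∑ j, M i j • Y j‖ ^ 2 ≤ s ^ 2 * ∑ i, ‖Y i‖ ^ 2)
    (hd : ∀ i, ‖d i‖ ≤ Λ * ‖Y i‖) :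
    ∑ i, ‖(∑ j, M i j • Y j) - α • (d i - vmean d) - α • k i‖ ^ 2
      ≤ (1 + (1 - s) / 8) * (1 - 41 / 50 * (1 - s)) ^ 2 * ∑ i, ‖Y i‖ ^ 2
        + (1 + 8 / (1 - s)) * α ^ 2 * ∑ i, ‖k i‖ ^ 2 := by
  set S := ∑ i, ‖Y i‖ ^ 2 with hS
  have hS0 : 0 ≤ S := by positivity
  set b := 9 / 50 * (1 - s) with hb
  have hb0 : 0 < b := by rw [hb]; linarith
  have hd2 : α ^ 2 * ∑ i, ‖d i - vmean d‖ ^ 2 ≤ b ^ 2 * S := by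
    have h1 : ∑ i, ‖d i‖ ^ 2 ≤ Λ ^ 2 * S := by
      rw [hS, Finset.mul_sum]
      refine Finset.sum_le_sum fun i _ => ?_
      rw [← mul_pow]
      exact pow_le_pow_left₀ (norm_nonneg _) (hd i) 2
    calc α ^ 2 * ∑ i, ‖d i - vmean d‖ ^ 2 ≤ α ^ 2 * (Λ ^ 2 * S) := by
          gcongr
          exact (sum_norm_sub_vmean_sq_le hN d).trans h1
      _ = (α * Λ) ^ 2 * S := by ring
      _ ≤ b ^ 2 * S := by gcongr
  -- The outer splitting isolates the heterogeneity; its parameter is of order `1 - s`, small enough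
  -- not to destroy the contraction.
  have hY1 := sum_norm_add_sq_le_young (fun i => (∑ j, M i j • Y j) + -(α • (d i - vmean d)))
    (fun i => -(α • k i)) (c := (1 - s) / 8) (by linarith)
  -- With `c = b / s` Young's inequality loses nothing against the triangle inequality: bounds `s²
  -- S` and `b² S` combine to `(s + b)² S`.
  have hY2 := sum_norm_add_sq_le_young (fun i => ∑ j, M i j • Y j)
    (fun i => -(α • (d i - vmean d))) (c := b / s) (by positivity)
  simp only [norm_neg, norm_smul, mul_pow, Real.norm_eq_abs, sq_abs, ← Finset.mul_sum]
    at hY1 hY2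
  have hY3 : ∑ i, ‖(∑ j, M i j • Y j) + -(α • (d i - vmean d))‖ ^ 2 ≤ (s + b) ^ 2 * S := by
    refine hY2.trans ?_
    calc _ ≤ (1 + b / s) * (s ^ 2 * S) + (1 + 1 / (b / s)) * (b ^ 2 * S) := by gcongr
      _ = (s + b) ^ 2 * S := by field_simp; ring
  have hsb : s + b = 1 - 41 / 50 * (1 - s) := by rw [hb]; ring
  rw [hsb] at hY3
  have h1s : 0 < 1 - s := by linarith
  simp only [sub_eq_add_neg (G := V)] at hY1 hY3 ⊢
  refine hY1.trans ?_
  calc _ ≤ (1 + (1 - s) / 8) * ((1 - 41 / 50 * (1 - s)) ^ 2 * S)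
        + (1 + 1 / ((1 - s) / 8)) * (α ^ 2 * ∑ i, ‖k i‖ ^ 2) := by gcongr
    _ = _ := by rw [one_div_div]; ring

/-- The effect of the noise on the consensus error in one step. -/
theorem sum_norm_sub_noise_sq_le {N : ℕ} (hN : 0 < N) (α : ℝ) (a e : Fin N → V)
    (ha : ∑ i, a i = 0) :
    ∑ i, ‖a i - α • (e i - vmean e)‖ ^ 2
      ≤ ∑ i, ‖a i‖ ^ 2 - 2 * α * ∑ i, inner ℝ (a i) (e i) + α ^ 2 * ∑ i, ‖e i‖ ^ 2 := by
  have h1 : ∑ i, inner ℝ (a i) (e i - vmean e) = ∑ i, inner ℝ (a i) (e i) := by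
    simp_rw [inner_sub_right]
    rw [Finset.sum_sub_distrib, ← sum_inner, ha, inner_zero_left, sub_zero]
  have h2 : ∑ i, ‖a i - α • (e i - vmean e)‖ ^ 2
      = ∑ i, ‖a i‖ ^ 2 - 2 * α * ∑ i, inner ℝ (a i) (e i - vmean e)
        + α ^ 2 * ∑ i, ‖e i - vmean e‖ ^ 2 := by
    rw [Finset.mul_sum, Finset.mul_sum, ← Finset.sum_sub_distrib, ← Finset.sum_add_distrib]
    refine Finset.sum_congr rfl fun i _ => ?_
    rw [norm_sub_sq_real, inner_smul_right, norm_smul, mul_pow, Real.norm_eq_abs, sq_abs]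
    ring
  rw [h2, h1]
  exact add_le_add_right (mul_le_mul_of_nonneg_left (sum_norm_sub_vmean_sq_le hN e)
    (sq_nonneg α)) _

/-- Summation of the weighted Lyapunov function over the rounds. -/
theorem sum_le_of_lyapunov {s β ν χ : ℝ} (hs0 : 0 < s) (hs1 : s < 1)
    (hβ : β ≤ 5 / 28 * (1 - s)) (hν : 0 ≤ ν) (hχ : 0 ≤ χ) (F Y H D : ℕ → ℝ)
    (hF : ∀ n, 0 ≤ F n) (hY : ∀ n, 0 ≤ Y n) (hPL : ∀ n, H n ≤ β * F n)
    (hdesc : ∀ n, F (n + 1) ≤ F n + D n + ν)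
    (hquad : ∀ n, (3 / 4 + s * s ^ n / 4) * D n + (1 - 7 / 5 * s ^ n) * H n
      ≤ ((1 - s ^ n) * (9 / 8 + (1 - s) / 20) + s ^ n * (21 / 50 + 7 / 100 * (1 - s))) * Y n)
    (hcons : ∀ n, Y (n + 1) ≤ (1 + (1 - s) / 8) * (1 - 41 / 50 * (1 - s)) ^ 2 * Y n + χ) (T : ℕ) :
    ∑ n ∈ Finset.range T, H n
      ≤ F 0 + Y 0 / (1 - s ^ 2) + T * (ν + 3 / 2 / (1 - s ^ 2) * χ) := by
  have hs2 : 0 < 1 - s ^ 2 := by nlinarith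
  have hω0 : ∀ n, 0 ≤ s ^ n := fun n => pow_nonneg hs0.le n
  have hω1 : ∀ n, s ^ n ≤ 1 := fun n => pow_le_one₀ hs0.le hs1.le
  set R := (1 + (1 - s) / 8) * (1 - 41 / 50 * (1 - s)) ^ 2 with hR
  -- Constant weights, with weight at most 1 on `F`, would need a weight at least `1 / (1 - R)` on
  -- `Y`, which exceeds `1 / (1 - s ^ 2)` since `R > s ^ 2`. Here `p 0 = 1` and `a 0 = 19 / 20 / (1
  -- - s ^ 2)`; the limit `3 / 2` of the numerator of `a` only affects the noise and heterogeneity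
  -- terms.
  set p : ℕ → ℝ := fun n => 3 / 4 + s ^ n / 4 with hp
  set a : ℕ → ℝ := fun n => (3 / 2 - 11 / 20 * s ^ n) / (1 - s ^ 2) with ha
  have hp0 : ∀ n, 0 ≤ p n := fun n => by have := hω0 n; simp only [hp]; linarith
  have hp1 : ∀ n, p n ≤ 1 := fun n => by have := hω1 n; simp only [hp]; linarith
  have ha0 : ∀ n, 0 ≤ a n := fun n =>
    div_nonneg (by have := hω1 n; linarith) hs2.le
  have ha1 : ∀ n, a n ≤ 3 / 2 / (1 - s ^ 2) := fun n => by
    have := hω0 n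
    simp only [ha]
    gcongr
    linarith
  have hcoef : ∀ n, (1 - s ^ n) * (9 / 8 + (1 - s) / 20) + s ^ n * (21 / 50 + 7 / 100 * (1 - s))
      + a (n + 1) * R ≤ a n := by
    intro n
    -- After multiplication by `1 - s ^ 2` the claim is affine in `s ^ n`; `e0` and `e1` are its
    -- cases `s ^ n = 0` and `s ^ n = 1`.
    have e0 : (9 / 8 + (1 - s) / 20) * (1 - s ^ 2) + 3 / 2 * R ≤ 3 / 2 := by
      obtain ⟨δ, rfl⟩ : ∃ δ, s = 1 - δ := ⟨1 - s, by ring⟩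
      rw [hR]
      have h0 : 0 < δ := by linarith
      have h1 : δ < 1 := by linarith
      have : 0 ≤ δ * (1 - δ) := by nlinarith
      nlinarith [mul_nonneg h0.le this]
    have e1 : (21 / 50 + 7 / 100 * (1 - s)) * (1 - s ^ 2) + (3 / 2 - 11 / 20 * s) * R
        ≤ 3 / 2 - 11 / 20 := by
      obtain ⟨δ, rfl⟩ : ∃ δ, s = 1 - δ := ⟨1 - s, by ring⟩
      rw [hR]
      have h0 : 0 < δ := by linarith
      have h1 : δ < 1 := by linarith
      have h2 : 0 ≤ δ * (1 - δ) := by nlinarith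
      nlinarith [mul_nonneg h0.le h2, mul_nonneg h0.le (mul_nonneg h0.le h2)]
    have e2 := mul_le_mul_of_nonneg_left e0 (sub_nonneg.2 (hω1 n))
    have e3 := mul_le_mul_of_nonneg_left e1 (hω0 n)
    simp only [ha]
    rw [le_div_iff₀ hs2, add_mul, div_mul_eq_mul_div _ _ R, div_mul_cancel₀ _ hs2.ne', pow_succ s n]
    linarith
  have hstep : ∀ n, p (n + 1) * F (n + 1) + a (n + 1) * Y (n + 1) + H n
      ≤ p n * F n + a n * Y n + (ν + 3 / 2 / (1 - s ^ 2) * χ) := by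
    intro n
    have e1 := mul_le_mul_of_nonneg_left (hdesc n) (hp0 (n + 1))
    have e2 := mul_le_mul_of_nonneg_left (hcons n) (ha0 (n + 1))
    have e3 := hquad n
    -- The weight drops by `s ^ n * (1 - s) / 4`, and `7 / 5 * (5 / 28) = 1 / 4`.
    have e4 : p (n + 1) * F n + 7 / 5 * s ^ n * H n ≤ p n * F n := by
      have h1 : H n ≤ 5 / 28 * (1 - s) * F n :=
        (hPL n).trans (mul_le_mul_of_nonneg_right hβ (hF n))
      have h2 := mul_le_mul_of_nonneg_left h1 (hω0 n)
      simp only [hp, pow_succ]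
      linarith
    have e5 := mul_le_mul_of_nonneg_right (hcoef n) (hY n)
    have e6 := mul_le_mul_of_nonneg_right (hp1 (n + 1)) hν
    have e7 := mul_le_mul_of_nonneg_right (ha1 (n + 1)) hχ
    have e8 : p (n + 1) = 3 / 4 + s * s ^ n / 4 := by simp only [hp, pow_succ]; ring
    rw [← e8] at e3
    linarith
  have hsum : ∀ T : ℕ, ∑ n ∈ Finset.range T, H n + (p T * F T + a T * Y T)
      ≤ p 0 * F 0 + a 0 * Y 0 + T * (ν + 3 / 2 / (1 - s ^ 2) * χ) := by
    intro T
    induction T with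
    | zero => simp
    | succ T ih =>
      rw [Finset.sum_range_succ]
      push_cast
      linarith [hstep T]
  have h1 := hsum T
  have h2 : 0 ≤ p T * F T + a T * Y T :=
    add_nonneg (mul_nonneg (hp0 T) (hF T)) (mul_nonneg (ha0 T) (hY T))
  have h3 : p 0 = 1 := by simp only [hp]; norm_num
  have h4 : a 0 * Y 0 ≤ Y 0 / (1 - s ^ 2) := by
    simp only [ha, pow_zero]
    rw [div_mul_eq_mul_div]
    gcongr
    linarith [hY 0]
  rw [h3] at h1
  linarith

end Algebra

/-! ### Noise independent of the current state -/

section Noise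

theorem MeasureTheory.MemLp.integrable_inner_two {Ω V : Type*} [MeasurableSpace Ω] {P : Measure Ω}
    [NormedAddCommGroup V] [InnerProductSpace ℝ V] {f g : Ω → V} (hf : MemLp f 2 P)
    (hg : MemLp g 2 P) : Integrable (fun ω => inner ℝ (f ω) (g ω)) P := by
  refine (((memLp_two_iff_integrable_sq_norm hf.1).1 hf).add
    ((memLp_two_iff_integrable_sq_norm hg.1).1 hg)).mono' (hf.1.inner hg.1)
    (ae_of_all _ fun ω => ?_)
  have h1 := norm_inner_le_norm (𝕜 := ℝ) (f ω) (g ω)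
  simp only [Pi.add_apply]
  nlinarith [sq_nonneg (‖f ω‖ - ‖g ω‖), sq_nonneg ‖f ω‖, sq_nonneg ‖g ω‖]

theorem MeasureTheory.MemLp.integrable_norm_sq {Ω V : Type*} [MeasurableSpace Ω] {P : Measure Ω}
    [NormedAddCommGroup V] {f : Ω → V} (hf : MemLp f 2 P) :
    Integrable (fun ω => ‖f ω‖ ^ 2) P :=
  (memLp_two_iff_integrable_sq_norm hf.1).1 hf

variable {Ω : Type*} [MeasurableSpace Ω] {P : Measure Ω} [IsProbabilityMeasure P]
  {E X : Type*} [MeasurableSpace E] [MeasurableSpace X]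
  {V : Type*} [NormedAddCommGroup V] [MeasurableSpace V] [BorelSpace V]
  [SecondCountableTopology V]

/-- Noise with conditional second moments bounded by `c` is square integrable. -/
theorem noise_memLp {U : Ω → E} {ξ : Ω → X} (hU : Measurable U) (hξ : Measurable ξ)
    (hind : IndepFun U ξ P) {h : E × X → V} (hh : Measurable h) {c : ℝ} (hc : 0 ≤ c)
    (hint : ∀ u, Integrable (fun ω => ‖h (u, ξ ω)‖ ^ 2) P)
    (hvar : ∀ u, ∫ ω, ‖h (u, ξ ω)‖ ^ 2 ∂P ≤ c) :
    MemLp (fun ω => h (U ω, ξ ω)) 2 P ∧ ∫ ω, ‖h (U ω, ξ ω)‖ ^ 2 ∂P ≤ c := by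
  have hmeas : Measurable fun ω => h (U ω, ξ ω) := hh.comp (hU.prodMk hξ)
  have hprod := (indepFun_iff_map_prod_eq_prod_map_map hU.aemeasurable hξ.aemeasurable).1 hind
  -- Integrability is still to be shown, so Tonelli for the lower integral comes first; by
  -- independence the joint law is a product and the state can be frozen.
  have hlin : ∫⁻ ω, ENNReal.ofReal (‖h (U ω, ξ ω)‖ ^ 2) ∂P ≤ ENNReal.ofReal c := by
    have hm : Measurable fun z : E × X => ENNReal.ofReal (‖h z‖ ^ 2) :=
      ((hh.norm).pow_const 2).ennreal_ofReal
    rw [← lintegral_map (f := fun z : E × X => ENNReal.ofReal (‖h z‖ ^ 2)) hm (hU.prodMk hξ), hprod,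
      lintegral_prod _ hm.aemeasurable]
    have : IsProbabilityMeasure (P.map U) := Measure.isProbabilityMeasure_map hU.aemeasurable
    calc ∫⁻ u, ∫⁻ x, ENNReal.ofReal (‖h (u, x)‖ ^ 2) ∂(P.map ξ) ∂(P.map U)
        ≤ ∫⁻ _, ENNReal.ofReal c ∂(P.map U) := by
          refine lintegral_mono fun u => ?_
          have hmu : Measurable fun x => ENNReal.ofReal (‖h (u, x)‖ ^ 2) :=
            hm.comp measurable_prodMk_left
          rw [lintegral_map hmu hξ,
            ← ofReal_integral_eq_lintegral_ofReal (hint u) (ae_of_all _ fun _ => sq_nonneg _)]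
          exact ENNReal.ofReal_le_ofReal (hvar u)
      _ = ENNReal.ofReal c := by simp
  have hint2 : Integrable (fun ω => ‖h (U ω, ξ ω)‖ ^ 2) P := by
    refine ⟨(hmeas.norm.pow_const 2).aestronglyMeasurable, ?_⟩
    rw [hasFiniteIntegral_iff_ofReal (ae_of_all _ fun _ => sq_nonneg _)]
    exact hlin.trans_lt ENNReal.ofReal_lt_top
  refine ⟨(memLp_two_iff_integrable_sq_norm hmeas.aestronglyMeasurable).2 hint2, ?_⟩
  rw [← ofReal_integral_eq_lintegral_ofReal hint2 (ae_of_all _ fun _ => sq_nonneg _)] at hlin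
  exact (ENNReal.ofReal_le_ofReal_iff hc).1 hlin

/-- Noise with vanishing conditional mean is orthogonal to every function of the state. -/
theorem noise_orthogonal [InnerProductSpace ℝ V] [CompleteSpace V] {U : Ω → E} {ξ : Ω → X} (hU : Measurable U)
    (hξ : Measurable ξ) (hind : IndepFun U ξ P) {h : E × X → V} (hh : Measurable h)
    (hint : ∀ u, Integrable (fun ω => h (u, ξ ω)) P)
    (hmean : ∀ u, ∫ ω, h (u, ξ ω) ∂P = 0)
    (hL2 : MemLp (fun ω => h (U ω, ξ ω)) 2 P) {φ : E → V} (hφ : Measurable φ)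
    (hφL2 : MemLp (fun ω => φ (U ω)) 2 P) :
    ∫ ω, inner ℝ (φ (U ω)) (h (U ω, ξ ω)) ∂P = 0 := by
  have hprod := (indepFun_iff_map_prod_eq_prod_map_map hU.aemeasurable hξ.aemeasurable).1 hind
  have hm : Measurable fun z : E × X => inner ℝ (φ z.1) (h z) :=
    (hφ.comp measurable_fst).inner hh
  have hUξ := hU.prodMk hξ
  have hI : Integrable (fun ω => inner ℝ (φ (U ω)) (h (U ω, ξ ω))) P := hφL2.integrable_inner_two hL2
  have hI2 : Integrable (fun z : E × X => inner ℝ (φ z.1) (h z)) ((P.map U).prod (P.map ξ)) := by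
    rw [← hprod]
    exact (integrable_map_measure hm.aestronglyMeasurable hUξ.aemeasurable).2 hI
  have : IsProbabilityMeasure (P.map U) := Measure.isProbabilityMeasure_map hU.aemeasurable
  have : IsProbabilityMeasure (P.map ξ) := Measure.isProbabilityMeasure_map hξ.aemeasurable
  calc ∫ ω, inner ℝ (φ (U ω)) (h (U ω, ξ ω)) ∂P
      = ∫ z, inner ℝ (φ z.1) (h z) ∂(P.map fun ω => (U ω, ξ ω)) :=
        (integral_map hUξ.aemeasurable hm.aestronglyMeasurable).symm
    _ = ∫ u, ∫ x, inner ℝ (φ u) (h (u, x)) ∂(P.map ξ) ∂(P.map U) := by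
        rw [hprod, integral_prod _ hI2]
    _ = 0 := by
        refine integral_eq_zero_of_ae (ae_of_all _ fun u => ?_)
        have hmu : Measurable fun x => inner ℝ (φ u) (h (u, x)) := hm.comp measurable_prodMk_left
        simp only [Pi.zero_apply]
        rw [integral_map hξ.aemeasurable hmu.aestronglyMeasurable, integral_inner (hint u), hmean,
          inner_zero_right]

end Noise

/-! ### Expected descent and averaging of noise -/

section Expectation

variable {Ω : Type*} [MeasurableSpace Ω] {P : Measure Ω} {V : Type*} [NormedAddCommGroup V]

theorem continuous_of_norm_sub_le {g : V → V} {Λ : ℝ}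
    (hg : ∀ x y, ‖g x - g y‖ ≤ Λ * ‖x - y‖) : Continuous g := by
  refine (LipschitzWith.of_dist_le_mul (K := Λ.toNNReal) fun x y => ?_).continuous
  rw [dist_eq_norm, dist_eq_norm]
  exact (hg x y).trans (mul_le_mul_of_nonneg_right (Real.le_coe_toNNReal Λ) (norm_nonneg _))

/-- A Lipschitz map grows at most linearly: `g x - g 0` is dominated by `Λ ‖x‖`. -/
theorem memLp_comp_of_norm_sub_le [IsFiniteMeasure P] {g : V → V} {Λ : ℝ}
    (hg : ∀ x y, ‖g x - g y‖ ≤ Λ * ‖x - y‖) {x : Ω → V} (hx : MemLp x 2 P) : MemLp (fun ω => g (x ω)) 2 P := by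
  have h1 : MemLp (fun ω => g (x ω) - g 0) 2 P := by
    refine hx.of_le_mul (c := Λ) ?_ (ae_of_all _ fun ω => ?_)
    · exact ((continuous_of_norm_sub_le hg).comp_aestronglyMeasurable hx.1).sub
        aestronglyMeasurable_const
    · simpa using hg (x ω) 0
  simpa [Pi.add_def] using h1.add (memLp_const (g 0))

variable [InnerProductSpace ℝ V]

theorem MeasureTheory.MemLp.vmean {N : ℕ} {x : Ω → Fin N → V}
    (hx : ∀ i, MemLp (fun ω => x ω i) 2 P) : MemLp (fun ω => vmean (x ω)) 2 P :=
  (memLp_finsetSum Finset.univ fun i _ => hx i).const_smul _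

theorem hasGradientAt_mean [CompleteSpace V] {N : ℕ} {φ : Fin N → V → ℝ} {g : Fin N → V → V}
    (hφ : ∀ i x, HasGradientAt (φ i) (g i x) x) (x : V) :
    HasGradientAt (fun x => (N : ℝ)⁻¹ * ∑ i, φ i x) (vmean fun i => g i x) x := by
  rw [hasGradientAt_iff_hasFDerivAt]
  have h := (HasFDerivAt.fun_sum fun i (_ : i ∈ Finset.univ) =>
    (hφ i x).hasFDerivAt).const_mul (N : ℝ)⁻¹
  simpa [vmean] using h

theorem norm_vmean_sub_vmean_le {N : ℕ} (hN : 0 < N) {g : Fin N → V → V} {Λ : ℝ}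
    (hg : ∀ i x y, ‖g i x - g i y‖ ≤ Λ * ‖x - y‖) (x y : V) :
    ‖vmean (fun i => g i x) - vmean fun i => g i y‖ ≤ Λ * ‖x - y‖ := by
  rw [vmean, vmean, ← smul_sub, ← Finset.sum_sub_distrib, norm_smul, norm_inv, Real.norm_natCast]
  calc (N : ℝ)⁻¹ * ‖∑ i, (g i x - g i y)‖ ≤ (N : ℝ)⁻¹ * ∑ _i : Fin N, Λ * ‖x - y‖ := by
        gcongr
        exact norm_sum_le_of_le _ fun i _ => hg i x y
    _ = Λ * ‖x - y‖ := by
        simp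
        field_simp

/-- The nonnegative function `f - c` lies below a quadratic polynomial, the smoothness bound at 0.
-/
theorem integrable_comp_of_lipschitz_gradient [CompleteSpace V] [IsFiniteMeasure P]
    {f : V → ℝ} {g : V → V} {Λ c : ℝ}
    (hf : ∀ x, HasGradientAt f (g x) x) (hg : ∀ x y, ‖g x - g y‖ ≤ Λ * ‖x - y‖)
    (hc : ∀ x, c ≤ f x) {x : Ω → V} (hx : MemLp x 2 P) : Integrable (fun ω => f (x ω)) P := by
  have hcont : Continuous f := continuous_iff_continuousAt.2 fun x => (hf x).continuousAt
  have hbd : Integrable (fun ω => f 0 + inner ℝ (g 0) (x ω) + Λ / 2 * ‖x ω‖ ^ 2 - c) P :=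
    (((integrable_const _).add ((memLp_const (g 0)).integrable_inner_two hx)).add
      (hx.integrable_norm_sq.const_mul _)).sub (integrable_const c)
  have h : Integrable (fun ω => f (x ω) - c) P := by
    refine hbd.mono' ((hcont.comp_aestronglyMeasurable hx.1).sub aestronglyMeasurable_const)
      (ae_of_all _ fun ω => ?_)
    rw [Real.norm_eq_abs, abs_of_nonneg (by linarith [hc (x ω)])]
    have := le_quadratic_of_lipschitz_gradient hf hg 0 (x ω)
    rw [zero_add] at this
    linarith
  simpa [Pi.add_def] using h.add (integrable_const c)

/-- The expected descent of a smooth function along a stochastic gradient step. -/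
theorem expected_descent [CompleteSpace V] [IsFiniteMeasure P] {f : V → ℝ} {g : V → V} {Λ c α v : ℝ} (hΛ : 0 ≤ Λ)
    (hf : ∀ x, HasGradientAt f (g x) x) (hg : ∀ x y, ‖g x - g y‖ ≤ Λ * ‖x - y‖)
    (hc : ∀ x, c ≤ f x) {x u e : Ω → V} (hx : MemLp x 2 P) (hu : MemLp u 2 P) (he : MemLp e 2 P)
    (hge : ∫ ω, inner ℝ (g (x ω)) (e ω) ∂P = 0) (hue : ∫ ω, inner ℝ (u ω) (e ω) ∂P = 0)
    (hv : ∫ ω, ‖e ω‖ ^ 2 ∂P ≤ v) :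
    ∫ ω, f (x ω - α • (u ω + e ω)) ∂P ≤ ∫ ω, f (x ω) ∂P
      - α * ∫ ω, inner ℝ (g (x ω)) (u ω) ∂P + Λ / 2 * α ^ 2 * (∫ ω, ‖u ω‖ ^ 2 ∂P + v) := by
  have hG := memLp_comp_of_norm_sub_le hg hx
  have hx' : MemLp (fun ω => x ω - α • (u ω + e ω)) 2 P := hx.sub ((hu.add he).const_smul α)
  have i1 := integrable_comp_of_lipschitz_gradient hf hg hc hx
  have i2 := hG.integrable_inner_two hu
  have i3 := hG.integrable_inner_two he
  have i4 := hu.integrable_norm_sq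
  have i5 := hu.integrable_inner_two he
  have i6 := he.integrable_norm_sq
  have hpt : ∀ ω, f (x ω - α • (u ω + e ω)) ≤ f (x ω) - α * inner ℝ (g (x ω)) (u ω)
      - α * inner ℝ (g (x ω)) (e ω) + (Λ / 2 * α ^ 2 * ‖u ω‖ ^ 2
        + Λ * α ^ 2 * inner ℝ (u ω) (e ω) + Λ / 2 * α ^ 2 * ‖e ω‖ ^ 2) := by
    intro ω
    have h := le_quadratic_of_lipschitz_gradient hf hg (x ω) (-(α • (u ω + e ω)))
    rw [← sub_eq_add_neg, inner_neg_right, inner_smul_right, inner_add_right, norm_neg, norm_smul,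
      mul_pow, Real.norm_eq_abs, sq_abs, norm_add_sq_real] at h
    linarith
  have h := integral_mono (integrable_comp_of_lipschitz_gradient hf hg hc hx')
    (((i1.sub (i2.const_mul α)).sub (i3.const_mul α)).add
      (((i4.const_mul (Λ / 2 * α ^ 2)).add (i5.const_mul (Λ * α ^ 2))).add
        (i6.const_mul (Λ / 2 * α ^ 2)))) hpt
  rw [integral_add' ((i1.sub (i2.const_mul α)).sub (i3.const_mul α))
      (((i4.const_mul (Λ / 2 * α ^ 2)).add (i5.const_mul (Λ * α ^ 2))).add
        (i6.const_mul (Λ / 2 * α ^ 2))),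
    integral_sub' (i1.sub (i2.const_mul α)) (i3.const_mul α), integral_sub' i1 (i2.const_mul α),
    integral_add' ((i4.const_mul (Λ / 2 * α ^ 2)).add (i5.const_mul (Λ * α ^ 2)))
      (i6.const_mul (Λ / 2 * α ^ 2)),
    integral_add' (i4.const_mul (Λ / 2 * α ^ 2)) (i5.const_mul (Λ * α ^ 2)),
    integral_const_mul, integral_const_mul, integral_const_mul, integral_const_mul,
    integral_const_mul, hge, hue] at h
  have hv' : Λ / 2 * α ^ 2 * ∫ ω, ‖e ω‖ ^ 2 ∂P ≤ Λ / 2 * α ^ 2 * v := by gcongr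
  linarith

/-- Averaging uncorrelated noise divides the variance bound by the number of agents. -/
theorem integral_norm_vmean_sq_le {N : ℕ} (hN : 0 < N) {e : Ω → Fin N → V} {c : ℝ}
    (he : ∀ i, MemLp (fun ω => e ω i) 2 P) (hc : ∀ i, ∫ ω, ‖e ω i‖ ^ 2 ∂P ≤ c)
    (hcross : ∀ i j, i ≠ j → ∫ ω, inner ℝ (e ω i) (e ω j) ∂P = 0) :
    ∫ ω, ‖vmean (e ω)‖ ^ 2 ∂P ≤ c / N := by
  have hpt : ∀ ω, ‖vmean (e ω)‖ ^ 2 = (N : ℝ)⁻¹ ^ 2 * ∑ i, ∑ j, inner ℝ (e ω i) (e ω j) := by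
    intro ω
    rw [vmean, norm_smul, mul_pow, ← real_inner_self_eq_norm_sq (∑ i, e ω i), sum_inner,
      Real.norm_eq_abs, sq_abs]
    simp_rw [inner_sum]
  simp_rw [hpt]
  rw [integral_const_mul, integral_finsetSum _ fun i _ =>
    integrable_finsetSum _ fun j _ => (he i).integrable_inner_two (he j)]
  have h1 : ∀ i, ∫ ω, ∑ j, inner ℝ (e ω i) (e ω j) ∂P ≤ c := by
    intro i
    rw [integral_finsetSum _ fun j _ => (he i).integrable_inner_two (he j),
      Finset.sum_eq_single i (fun j _ hj => hcross i j hj.symm) (by simp)]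
    simpa [real_inner_self_eq_norm_sq] using hc i
  calc (N : ℝ)⁻¹ ^ 2 * ∑ i, ∫ ω, ∑ j, inner ℝ (e ω i) (e ω j) ∂P
      ≤ (N : ℝ)⁻¹ ^ 2 * ∑ _i : Fin N, c := by
        gcongr with i
        exact h1 i
    _ = c / N := by
        simp
        field_simp

end Expectation

/-! ### Decentralized stochastic gradient descent -/

section DecentralizedSGD

variable {V : Type*} [NormedAddCommGroup V] [InnerProductSpace ℝ V] {N : ℕ}

/-- The mean of the agents follows the averaged stochastic gradient. -/
theorem vmean_mix_sub {M : Matrix (Fin N) (Fin N) ℝ} (hcol : ∀ j, ∑ i, M i j = 1) (α : ℝ)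
    (x g e : Fin N → V) :
    vmean (fun i => (∑ j, M i j • x j) - α • (g i + e i))
      = vmean x - α • (vmean g + vmean e) := by
  have h : ∑ i, ∑ j, M i j • x j = ∑ j, x j := by
    rw [Finset.sum_comm]
    refine Finset.sum_congr rfl fun j _ => ?_
    rw [← Finset.sum_smul, hcol, one_smul]
  simp only [vmean, Finset.sum_sub_distrib, h, ← Finset.smul_sum, Finset.sum_add_distrib,
    smul_sub, smul_add, smul_comm α]

/-- The deviations of the agents from their mean after one round. -/
theorem mix_sub_vmean_mix {M : Matrix (Fin N) (Fin N) ℝ} (hrow : ∀ i, ∑ j, M i j = 1)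
    (hcol : ∀ j, ∑ i, M i j = 1) (α : ℝ) (x g e h : Fin N → V) (i : Fin N) :
    (∑ j, M i j • x j) - α • (g i + e i) - vmean (fun i => (∑ j, M i j • x j) - α • (g i + e i))
      = ((∑ j, M i j • (x j - vmean x)) - α • ((g i - h i) - vmean fun i => g i - h i)
          - α • (h i - vmean h)) - α • (e i - vmean e) := by
  have h1 : ∑ j, M i j • (x j - vmean x) = (∑ j, M i j • x j) - vmean x := by
    simp_rw [smul_sub]
    rw [Finset.sum_sub_distrib, ← Finset.sum_smul, hrow, one_smul]
  have h2 : vmean (fun i => g i - h i) = vmean g - vmean h := by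
    simp only [vmean, Finset.sum_sub_distrib, smul_sub]
  rw [vmean_mix_sub hcol, h1, h2]
  module

/-- Convergence of decentralized stochastic gradient descent for smooth losses, with noise that is
orthogonal to the functions of the current state and uncorrelated between the agents. -/
theorem decentralized_sgd_bound {Ω : Type*} [MeasurableSpace Ω] {P : Measure Ω}
    [IsProbabilityMeasure P] [CompleteSpace V] [MeasurableSpace V] [BorelSpace V]
    [SecondCountableTopology V]
    (hN : 0 < N)
    {φ : Fin N → V → ℝ} {g : Fin N → V → V} {Λ c κ ζ α s : ℝ} (hΛ : 0 < Λ)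
    (hφ : ∀ i x, HasGradientAt (φ i) (g i x) x)
    (hg : ∀ i x y, ‖g i x - g i y‖ ≤ Λ * ‖x - y‖)
    (hc : ∀ x, c ≤ (N : ℝ)⁻¹ * ∑ i, φ i x)
    (hκ : ∀ x, (N : ℝ)⁻¹ * ∑ i, ‖g i x - vmean fun i => g i x‖ ^ 2 ≤ κ ^ 2)
    {M : Matrix (Fin N) (Fin N) ℝ} (hrow : ∀ i, ∑ j, M i j = 1) (hcol : ∀ j, ∑ i, M i j = 1)
    (hs0 : 0 < s) (hs1 : s < 1)
    (hmix : ∀ Y : Fin N → V, ∑ i, Y i = 0 →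
      ∑ i, ‖∑ j, M i j • Y j‖ ^ 2 ≤ s ^ 2 * ∑ i, ‖Y i‖ ^ 2)
    (hα : 0 < α) (hαΛ : α * Λ ≤ 5 / 28 * (1 - s))
    {x e : ℕ → Ω → Fin N → V} {B : Fin N → V} (hx0 : ∀ ω, x 0 ω = B)
    (hx : ∀ n ω i, x (n + 1) ω i = (∑ j, M i j • x n ω j) - α • (g i (x n ω i) + e n ω i))
    (he : ∀ n i, MemLp (fun ω => e n ω i) 2 P)
    (hζ : ∀ n i, ∫ ω, ‖e n ω i‖ ^ 2 ∂P ≤ ζ ^ 2)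
    (horth : ∀ n i (ψ : (Fin N → V) → V), Measurable ψ → MemLp (fun ω => ψ (x n ω)) 2 P →
      ∫ ω, inner ℝ (ψ (x n ω)) (e n ω i) ∂P = 0)
    (hcross : ∀ n i j, i ≠ j → ∫ ω, inner ℝ (e n ω i) (e n ω j) ∂P = 0) :
    (∀ n, Integrable (fun ω => ‖vmean fun i => g i (vmean (x n ω))‖ ^ 2) P) ∧
    ∀ T : ℕ, ∑ n ∈ Finset.range T, ∫ ω, ‖vmean fun i => g i (vmean (x n ω))‖ ^ 2 ∂P
      ≤ 2 / α * ((N : ℝ)⁻¹ * ∑ i, φ i (vmean B) - c)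
        + Λ ^ 2 / N * (∑ i, ‖B i‖ ^ 2) / (1 - s ^ 2)
        + T * (α * Λ * ζ ^ 2 / N + 3 / 2 / (1 - s ^ 2) *
          ((1 + 8 / (1 - s)) * (α * Λ) ^ 2 * κ ^ 2 + (α * Λ) ^ 2 * ζ ^ 2)) := by
  have hNpos : (0 : ℝ) < N := by exact_mod_cast hN
  have h1s : 0 < 1 - s := by linarith
  set f : V → ℝ := fun x => (N : ℝ)⁻¹ * ∑ i, φ i x with hf
  set gb : V → V := fun x => vmean fun i => g i x with hgb
  have hfg : ∀ x, HasGradientAt f (gb x) x := hasGradientAt_mean hφ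
  have hgbL : ∀ x y, ‖gb x - gb y‖ ≤ Λ * ‖x - y‖ := norm_vmean_sub_vmean_le hN hg
  have hgm : ∀ i, Measurable (g i) := fun i => (continuous_of_norm_sub_le (hg i)).measurable
  have hgbm : Measurable gb := (continuous_of_norm_sub_le hgbL).measurable
  have hvm : Measurable (vmean : (Fin N → V) → V) := by
    unfold vmean; fun_prop
  have hum : Measurable fun y : Fin N → V => vmean fun i => g i (y i) := by
    unfold vmean
    exact (Finset.measurable_fun_sum _ fun i _ => (hgm i).comp (measurable_pi_apply i)).const_smul _
  -- square integrability of the iterates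
  have hxL : ∀ n i, MemLp (fun ω => x n ω i) 2 P := by
    intro n
    induction n with
    | zero => intro i; simp_rw [hx0]; exact memLp_const _
    | succ n ih =>
      intro i
      simp_rw [hx]
      exact (memLp_finsetSum Finset.univ fun j _ => (ih j).const_smul _).sub
        (((memLp_comp_of_norm_sub_le (hg i) (ih i)).add (he n i)).const_smul α)
  have hxbL : ∀ n, MemLp (fun ω => vmean (x n ω)) 2 P := fun n => MemLp.vmean (hxL n)
  have hgL : ∀ n i, MemLp (fun ω => g i (x n ω i)) 2 P := fun n i =>
    memLp_comp_of_norm_sub_le (hg i) (hxL n i)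
  have huL : ∀ n, MemLp (fun ω => vmean fun i => g i (x n ω i)) 2 P := fun n =>
    MemLp.vmean (hgL n)
  have hGL : ∀ n, MemLp (fun ω => gb (vmean (x n ω))) 2 P := fun n =>
    memLp_comp_of_norm_sub_le hgbL (hxbL n)
  have hebL : ∀ n, MemLp (fun ω => vmean (e n ω)) 2 P := fun n => MemLp.vmean (he n)
  have hYL : ∀ n i, MemLp (fun ω => x n ω i - vmean (x n ω)) 2 P := fun n i =>
    (hxL n i).sub (hxbL n)
  have horthb : ∀ n (ψ : (Fin N → V) → V), Measurable ψ → MemLp (fun ω => ψ (x n ω)) 2 P →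
      ∫ ω, inner ℝ (ψ (x n ω)) (vmean (e n ω)) ∂P = 0 := by
    intro n ψ hψ hψL
    simp only [vmean, inner_smul_right, inner_sum]
    rw [integral_const_mul, integral_finsetSum _ fun i _ => hψL.integrable_inner_two (he n i)]
    simp [horth n _ ψ hψ hψL]
  have hfI : ∀ n, Integrable (fun ω => f (vmean (x n ω))) P := fun n =>
    integrable_comp_of_lipschitz_gradient hfg hgbL hc (hxbL n)
  refine ⟨fun n => (hGL n).integrable_norm_sq, fun T => ?_⟩
  set S : ℕ → Ω → ℝ := fun n ω => ∑ i, ‖x n ω i - vmean (x n ω)‖ ^ 2 with hS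
  have hSI : ∀ n, Integrable (S n) P := fun n =>
    integrable_finsetSum _ fun i _ => (hYL n i).integrable_norm_sq
  have hDI1 : ∀ n, Integrable (fun ω => inner ℝ (gb (vmean (x n ω)))
      (vmean fun i => g i (x n ω i))) P := fun n => (hGL n).integrable_inner_two (huL n)
  have hDI2 : ∀ n, Integrable (fun ω => ‖vmean fun i => g i (x n ω i)‖ ^ 2) P := fun n =>
    (huL n).integrable_norm_sq
  -- The factor `2 / α` turns the descent inequality into one for `-2⟨G, u⟩ + αΛ‖u‖²`, where `G` is
  -- the gradient at the mean and `u` the mean of the local gradients; the factor `Λ² / N` makes the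
  -- consensus term dominate `‖u - G‖²`.
  have main := sum_le_of_lyapunov (s := s) (β := α * Λ) (ν := α * Λ * ζ ^ 2 / N)
    (χ := (1 + 8 / (1 - s)) * (α * Λ) ^ 2 * κ ^ 2 + (α * Λ) ^ 2 * ζ ^ 2) hs0 hs1 hαΛ
    (by positivity) (by positivity)
    (fun n => 2 / α * (∫ ω, f (vmean (x n ω)) ∂P - c))
    (fun n => Λ ^ 2 / N * ∫ ω, S n ω ∂P)
    (fun n => ∫ ω, ‖gb (vmean (x n ω))‖ ^ 2 ∂P)
    (fun n => -2 * ∫ ω, inner ℝ (gb (vmean (x n ω))) (vmean fun i => g i (x n ω i)) ∂P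
      + α * Λ * ∫ ω, ‖vmean fun i => g i (x n ω i)‖ ^ 2 ∂P)
    ?_ ?_ ?_ ?_ ?_ ?_ T
  · refine main.trans ?_
    have h0 : Λ ^ 2 / N * ∫ ω, S 0 ω ∂P ≤ Λ ^ 2 / N * ∑ i, ‖B i‖ ^ 2 := by
      simp only [hS, hx0, integral_const, probReal_univ, one_smul]
      exact mul_le_mul_of_nonneg_left (sum_norm_sub_vmean_sq_le hN B) (by positivity)
    simp only [hx0, integral_const, probReal_univ, one_smul] at h0 ⊢
    have hs2 : 0 < 1 - s ^ 2 := by nlinarith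
    gcongr
  · intro n
    have h := integral_mono (integrable_const c) (hfI n) fun ω => hc _
    simp only [integral_const, probReal_univ, one_smul] at h
    have : 0 ≤ ∫ ω, f (vmean (x n ω)) ∂P - c := by linarith
    positivity
  · intro n
    have : 0 ≤ ∫ ω, S n ω ∂P := integral_nonneg fun ω => by simp only [hS]; positivity
    positivity
  · intro n
    have h := integral_mono (hGL n).integrable_norm_sq
      (((hfI n).sub (integrable_const c)).const_mul (2 * Λ))
      fun ω => norm_gradient_sq_le hΛ hfg hgbL hc (vmean (x n ω))
    refine h.trans_eq ?_
    rw [integral_const_mul, integral_sub' (hfI n) (integrable_const c)]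
    simp only [integral_const, probReal_univ, one_smul]
    field_simp
  · intro n
    have h := expected_descent hΛ.le hfg hgbL hc (α := α) (v := ζ ^ 2 / N) (hxbL n) (huL n) (hebL n)
      (horthb n (fun y => gb (vmean y)) (hgbm.comp hvm) (hGL n))
      (horthb n (fun y => vmean fun i => g i (y i)) hum (huL n))
      (integral_norm_vmean_sq_le hN (he n) (hζ n) (hcross n))
    have hstep : ∀ ω, vmean (x n ω) - α • ((vmean fun i => g i (x n ω i)) + vmean (e n ω))
        = vmean (x (n + 1) ω) := by
      intro ω
      rw [← vmean_mix_sub hcol α (x n ω) (fun i => g i (x n ω i)) (e n ω)]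
      exact congrArg vmean (funext fun i => (hx n ω i).symm)
    simp_rw [hstep] at h
    have h2 := mul_le_mul_of_nonneg_left h (by positivity : 0 ≤ 2 / α)
    have h3 : ∀ A I U : ℝ, 2 / α * (A - α * I + Λ / 2 * α ^ 2 * (U + ζ ^ 2 / N))
        = 2 / α * A + (-2 * I + α * Λ * U) + α * Λ * ζ ^ 2 / N := by
      intro A I U; field_simp; ring
    rw [h3] at h2
    linarith
  · intro n
    set C := (1 - s ^ n) * (9 / 8 + (1 - s) / 20) + s ^ n * (21 / 50 + 7 / 100 * (1 - s)) with hC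
    have hω0 : 0 ≤ s ^ n := pow_nonneg hs0.le n
    have hω1 : s ^ n ≤ 1 := pow_le_one₀ hs0.le hs1.le
    have hC0 : 0 ≤ C := by
      have : 0 ≤ 1 - s ^ n := by linarith
      positivity
    have hpt : ∀ ω, (3 / 4 + s * s ^ n / 4) * (-2 * inner ℝ (gb (vmean (x n ω)))
        (vmean fun i => g i (x n ω i)) + α * Λ * ‖vmean fun i => g i (x n ω i)‖ ^ 2)
        + (1 - 7 / 5 * s ^ n) * ‖gb (vmean (x n ω))‖ ^ 2 ≤ C * (Λ ^ 2 / N * S n ω) := by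
      intro ω
      have h := descent_quadratic_le (gb (vmean (x n ω)))
        ((vmean fun i => g i (x n ω i)) - gb (vmean (x n ω))) hs0.le hs1.le
        (by positivity : 0 ≤ α * Λ) (by linarith) hω0 hω1
      rw [add_sub_cancel] at h
      refine h.trans (mul_le_mul_of_nonneg_left ?_ hC0)
      have h1 := norm_vmean_sq_le hN fun i => g i (x n ω i) - g i (vmean (x n ω))
      have h2 : (vmean fun i => g i (x n ω i) - g i (vmean (x n ω)))
          = (vmean fun i => g i (x n ω i)) - gb (vmean (x n ω)) := by
        simp only [hgb, vmean, Finset.sum_sub_distrib, smul_sub]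
      rw [h2] at h1
      refine h1.trans ?_
      rw [div_mul_eq_mul_div, inv_mul_eq_div, hS, Finset.mul_sum]
      gcongr with i
      rw [← mul_pow]
      exact pow_le_pow_left₀ (norm_nonneg _) (hg i _ _) 2
    have h := integral_mono
      (((((hDI1 n).const_mul (-2)).add ((hDI2 n).const_mul (α * Λ))).const_mul
        (3 / 4 + s * s ^ n / 4)).add ((hGL n).integrable_norm_sq.const_mul (1 - 7 / 5 * s ^ n)))
      (((hSI n).const_mul (Λ ^ 2 / N)).const_mul C) hpt
    rw [integral_add' ((((hDI1 n).const_mul (-2)).add ((hDI2 n).const_mul (α * Λ))).const_mul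
        (3 / 4 + s * s ^ n / 4)) ((hGL n).integrable_norm_sq.const_mul (1 - 7 / 5 * s ^ n)),
      integral_const_mul, integral_const_mul, integral_const_mul, integral_const_mul,
      integral_add' ((hDI1 n).const_mul (-2)) ((hDI2 n).const_mul (α * Λ)),
      integral_const_mul, integral_const_mul] at h
    exact h
  · intro n
    set R := (1 + (1 - s) / 8) * (1 - 41 / 50 * (1 - s)) ^ 2 with hR
    -- The noiseless part of the new deviations, as a function of the state alone, so that
    -- orthogonality of the noise applies to it.
    let am : (Fin N → V) → Fin N → V := fun y i =>
      (∑ j, M i j • (y j - vmean y))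
        - α • ((g i (y i) - g i (vmean y)) - vmean fun i => g i (y i) - g i (vmean y))
        - α • (g i (vmean y) - gb (vmean y))
    let a : Ω → Fin N → V := fun ω => am (x n ω)
    have ham : ∀ i, Measurable fun y => am y i := by
      intro i
      have m1 : ∀ i, Measurable fun y : Fin N → V => g i (y i) - g i (vmean y) := fun i =>
        ((hgm i).comp (measurable_pi_apply i)).sub ((hgm i).comp hvm)
      have m2 : Measurable fun y : Fin N → V => vmean fun i => g i (y i) - g i (vmean y) := by
        unfold vmean
        exact (Finset.measurable_fun_sum _ fun i _ => m1 i).const_smul _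
      exact ((Finset.measurable_fun_sum _ fun j _ =>
        ((measurable_pi_apply j).sub hvm).const_smul (M i j)).sub
          (((m1 i).sub m2).const_smul α)).sub
            ((((hgm i).comp hvm).sub (hgbm.comp hvm)).const_smul α)
    have haL : ∀ i, MemLp (fun ω => a ω i) 2 P := by
      intro i
      have m1 : ∀ i, MemLp (fun ω => g i (x n ω i) - g i (vmean (x n ω))) 2 P := fun i =>
        (hgL n i).sub (memLp_comp_of_norm_sub_le (hg i) (hxbL n))
      exact ((memLp_finsetSum Finset.univ fun j _ => (hYL n j).const_smul (M i j)).sub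
        (((m1 i).sub (MemLp.vmean m1)).const_smul α)).sub
          (((memLp_comp_of_norm_sub_le (hg i) (hxbL n)).sub (hGL n)).const_smul α)
    have hpt : ∀ ω, S (n + 1) ω ≤ R * S n ω + (1 + 8 / (1 - s)) * α ^ 2 * (N * κ ^ 2)
        - 2 * α * ∑ i, inner ℝ (a ω i) (e n ω i) + α ^ 2 * ∑ i, ‖e n ω i‖ ^ 2 := by
      intro ω
      have hY0 : ∑ i, (x n ω i - vmean (x n ω)) = 0 := sum_sub_vmean hN _
      have ha0 : ∑ i, a ω i = 0 := by
        have e1 : ∑ i, ∑ j, M i j • (x n ω j - vmean (x n ω)) = 0 := by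
          rw [Finset.sum_comm]
          simp_rw [← Finset.sum_smul, hcol, one_smul]
          exact hY0
        simp only [a, am, Finset.sum_sub_distrib, ← Finset.smul_sum]
        rw [e1, ← Finset.sum_sub_distrib, ← Finset.sum_sub_distrib, sum_sub_vmean hN,
          ← Finset.sum_sub_distrib, sum_sub_vmean hN]
        simp
      have h1 : S (n + 1) ω = ∑ i, ‖a ω i - α • (e n ω i - vmean (e n ω))‖ ^ 2 := by
        simp only [hS]
        refine Finset.sum_congr rfl fun i _ => ?_
        have e1 : x (n + 1) ω = fun i => (∑ j, M i j • x n ω j) - α • (g i (x n ω i) + e n ω i) :=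
          funext fun i => hx n ω i
        rw [e1, mix_sub_vmean_mix hrow hcol α (x n ω) (fun i => g i (x n ω i)) (e n ω)
          (fun i => g i (vmean (x n ω)))]
      have h2 := sum_norm_sub_noise_sq_le hN α (a ω) (e n ω) ha0
      have h3 : ∑ i, ‖a ω i‖ ^ 2 ≤ R * S n ω + (1 + 8 / (1 - s)) * α ^ 2
          * ∑ i, ‖g i (vmean (x n ω)) - gb (vmean (x n ω))‖ ^ 2 := consensus_step_le hN hs0 hs1 hα.le (by linarith : α * Λ ≤ 9 / 50 * (1 - s)) hΛ.le
        (fun i => x n ω i - vmean (x n ω)) (fun i => g i (x n ω i) - g i (vmean (x n ω)))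
        (fun i => g i (vmean (x n ω)) - gb (vmean (x n ω))) (hmix _ hY0) (fun i => hg i _ _)
      have h4 : ∑ i, ‖g i (vmean (x n ω)) - gb (vmean (x n ω))‖ ^ 2 ≤ N * κ ^ 2 := by
        have := hκ (vmean (x n ω))
        rwa [inv_mul_le_iff₀ hNpos] at this
      have h5 : (1 + 8 / (1 - s)) * α ^ 2 * ∑ i, ‖g i (vmean (x n ω)) - gb (vmean (x n ω))‖ ^ 2
          ≤ (1 + 8 / (1 - s)) * α ^ 2 * (N * κ ^ 2) := by gcongr
      rw [h1]
      linarith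
    have hI1 : Integrable (fun ω => ∑ i, inner ℝ (a ω i) (e n ω i)) P :=
      integrable_finsetSum _ fun i _ => (haL i).integrable_inner_two (he n i)
    have hI2 : Integrable (fun ω => ∑ i, ‖e n ω i‖ ^ 2) P :=
      integrable_finsetSum _ fun i _ => (he n i).integrable_norm_sq
    have hz : ∫ ω, ∑ i, inner ℝ (a ω i) (e n ω i) ∂P = 0 := by
      rw [integral_finsetSum _ fun i _ => (haL i).integrable_inner_two (he n i)]
      exact Finset.sum_eq_zero fun i _ => horth n i (fun y => am y i) (ham i) (haL i)
    have hE : ∫ ω, ∑ i, ‖e n ω i‖ ^ 2 ∂P ≤ N * ζ ^ 2 := by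
      rw [integral_finsetSum _ fun i _ => (he n i).integrable_norm_sq]
      calc _ ≤ ∑ _i : Fin N, ζ ^ 2 := Finset.sum_le_sum fun i _ => hζ n i
        _ = N * ζ ^ 2 := by simp
    have j1 : Integrable (fun ω => R * S n ω + (1 + 8 / (1 - s)) * α ^ 2 * (N * κ ^ 2)) P :=
      ((hSI n).const_mul R).add (integrable_const _)
    have j2 := hI1.const_mul (2 * α)
    have j3 := hI2.const_mul (α ^ 2)
    have h := integral_mono (hSI (n + 1)) ((j1.sub j2).add j3) hpt
    rw [integral_add' (j1.sub j2) j3, integral_sub' j1 j2,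
      integral_add ((hSI n).const_mul R) (integrable_const _), integral_const, probReal_univ,
      one_smul, integral_const_mul, integral_const_mul, integral_const_mul, hz] at h
    have h6 : α ^ 2 * ∫ ω, ∑ i, ‖e n ω i‖ ^ 2 ∂P ≤ α ^ 2 * (N * ζ ^ 2) := by gcongr
    have h7 : ∫ ω, S (n + 1) ω ∂P ≤ R * ∫ ω, S n ω ∂P
        + (1 + 8 / (1 - s)) * α ^ 2 * (N * κ ^ 2) + α ^ 2 * (N * ζ ^ 2) := by linarith
    calc Λ ^ 2 / N * ∫ ω, S (n + 1) ω ∂P ≤ Λ ^ 2 / N * (R * ∫ ω, S n ω ∂P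
        + (1 + 8 / (1 - s)) * α ^ 2 * (N * κ ^ 2) + α ^ 2 * (N * ζ ^ 2)) := by gcongr
      _ = _ := by field_simp; ring

end DecentralizedSGD

/-! ### Tail of the norm of a Gaussian matrix -/

section GaussianNorm

theorem integral_exp_mul_sq_gaussianReal {a : ℝ} (ha : a < 1 / 2) :
    ∫ x, Real.exp (a * x ^ 2) ∂(gaussianReal 0 1) = (√(1 - 2 * a))⁻¹ := by
  rw [integral_gaussianReal_eq_integral_smul one_ne_zero]
  have h : ∀ x : ℝ, gaussianPDFReal 0 1 x • Real.exp (a * x ^ 2)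
      = (√(2 * Real.pi))⁻¹ * Real.exp (-(1 / 2 - a) * x ^ 2) := by
    intro x
    simp only [gaussianPDFReal, smul_eq_mul, NNReal.coe_one, mul_one, sub_zero]
    rw [mul_assoc, ← Real.exp_add]
    congr 2
    ring
  simp_rw [h]
  rw [integral_const_mul, integral_gaussian, ← Real.sqrt_inv, ← Real.sqrt_inv,
    ← Real.sqrt_mul (by positivity)]
  congr 1
  have : 1 - 2 * a ≠ 0 := by linarith
  have : 1 / 2 - a ≠ 0 := by linarith
  field_simp

/-- A non-integrable function has Bochner integral 0, whereas the integral was computed to be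
positive. -/
theorem integrable_exp_mul_sq_gaussianReal {a : ℝ} (ha : a < 1 / 2) :
    Integrable (fun x => Real.exp (a * x ^ 2)) (gaussianReal 0 1) := by
  by_contra h
  have h1 := integral_exp_mul_sq_gaussianReal ha
  rw [integral_undef h] at h1
  have : 0 < (√(1 - 2 * a))⁻¹ := by
    have : 0 < 1 - 2 * a := by linarith
    positivity
  linarith

/-- The Chernoff bound for the norm of a standard Gaussian vector. -/
theorem gaussian_norm_tail {ι : Type*} [Fintype ι] [Nonempty ι] {t : ℝ} (ht : 0 ≤ t) :
    (Measure.pi fun _ : ι => gaussianReal 0 1).real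
      {x | (√(Fintype.card ι : ℝ) + t) ^ 2 ≤ ∑ i, x i ^ 2}
      ≤ Real.exp (-t ^ 2 / 2) := by
  set n : ℝ := (Fintype.card ι : ℝ) with hn
  have hn0 : 0 < n := Nat.cast_pos.2 Fintype.card_pos
  have hsq : 0 < √n := Real.sqrt_pos.2 hn0
  set v : ℝ := 1 + t / √n with hv
  have hv1 : 1 ≤ v := by rw [hv]; have : 0 ≤ t / √n := by positivity
                         linarith
  -- The optimal Chernoff parameter: `1 - 2a = v⁻²`, so the moment generating function is `v ^ n`.
  -- Then `v ≤ exp (t / √n)` cancels the cross term `√n t` of the exponent and leaves `-t² / 2`.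
  set a : ℝ := (1 - (v ^ 2)⁻¹) / 2 with ha
  have hv2 : (v ^ 2)⁻¹ ≤ 1 := inv_le_one_of_one_le₀ (one_le_pow₀ hv1)
  have ha0 : 0 ≤ a := by rw [ha]; linarith
  have hvp : 0 < (v ^ 2)⁻¹ := by positivity
  have ha1 : a < 1 / 2 := by rw [ha]; linarith
  have hprod : ∀ x : ι → ℝ, Real.exp (a * ∑ i, x i ^ 2) = ∏ i, Real.exp (a * x i ^ 2) := by
    intro x; rw [Finset.mul_sum, Real.exp_sum]
  have hint : Integrable (fun x : ι → ℝ => Real.exp (a * ∑ i, x i ^ 2))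
      (Measure.pi fun _ : ι => gaussianReal 0 1) := by
    simp_rw [hprod]
    exact Integrable.fintype_prod fun _ => integrable_exp_mul_sq_gaussianReal ha1
  have hmgf : mgf (fun x : ι → ℝ => ∑ i, x i ^ 2) (Measure.pi fun _ : ι => gaussianReal 0 1) a
      = v ^ (Fintype.card ι) := by
    simp_rw [mgf, hprod]
    rw [integral_fintype_prod_eq_prod (fun _ : ι => fun y : ℝ => Real.exp (a * y ^ 2))]
    simp_rw [integral_exp_mul_sq_gaussianReal ha1]
    have : 1 - 2 * a = (v ^ 2)⁻¹ := by rw [ha]; ring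
    rw [this, Real.sqrt_inv, Real.sqrt_sq (by linarith), inv_inv]
    simp
  have h := measure_ge_le_exp_mul_mgf (μ := Measure.pi fun _ : ι => gaussianReal 0 1)
    (X := fun x : ι → ℝ => ∑ i, x i ^ 2) ((√n + t) ^ 2) ha0 hint
  rw [hmgf] at h
  refine h.trans ?_
  have hvexp : v ≤ Real.exp (t / √n) := by
    rw [hv, add_comm]; exact Real.add_one_le_exp _
  calc Real.exp (-a * (√n + t) ^ 2) * v ^ (Fintype.card ι)
      ≤ Real.exp (-a * (√n + t) ^ 2) * (Real.exp (t / √n)) ^ (Fintype.card ι) := by gcongr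
    _ = Real.exp (-t ^ 2 / 2) := by
        rw [← Real.exp_nat_mul, ← Real.exp_add, ← hn]
        congr 1
        have h1 : √n + t = √n * v := by rw [hv]; field_simp
        have h2 : a * (√n * v) ^ 2 = n * (v ^ 2 - 1) / 2 := by
          rw [mul_pow, Real.sq_sqrt hn0.le, ha]; field_simp
        have h3 : n * (t / √n) = √n * t := by
          nth_rewrite 1 [← Real.mul_self_sqrt hn0.le]; field_simp
        have h4 : n * (v ^ 2 - 1) = 2 * √n * t + t ^ 2 := by
          have : n * (v ^ 2 - 1) = (√n * v) ^ 2 - n := by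
            rw [mul_pow, Real.sq_sqrt hn0.le]; ring
          rw [this, ← h1, add_sq, Real.sq_sqrt hn0.le]; ring
        rw [h1, h3, neg_mul, h2, h4]
        ring

/-- Concentration of the Frobenius norm of a Gaussian matrix. -/
theorem DLoRA.gaussianMatrix_norm_le (r k : ℕ) {t : ℝ} (ht : 0 ≤ t) :
    1 - Real.exp (-t ^ 2 / 2)
      ≤ (DLoRA.gaussianMatrix r k).real {A | ‖A‖ ≤ √((k : ℝ) * r) + t} := by
  have hmeas : Measurable (WithLp.toLp 2 : (Fin r × Fin k → ℝ) → DLoRA.Mat r k) :=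
    (PiLp.continuous_toLp 2 _).measurable
  have hS : MeasurableSet {A : DLoRA.Mat r k | ‖A‖ ≤ √((k : ℝ) * r) + t} :=
    measurableSet_le measurable_norm measurable_const
  rw [measureReal_def, DLoRA.gaussianMatrix, Measure.map_apply hmeas hS, ← measureReal_def]
  set μ := Measure.pi fun _ : Fin r × Fin k => gaussianReal 0 1 with hμ
  set S := (WithLp.toLp 2 : (Fin r × Fin k → ℝ) → DLoRA.Mat r k) ⁻¹'
    {A | ‖A‖ ≤ √((k : ℝ) * r) + t} with hSdef
  have hsq : ∀ x, ‖(WithLp.toLp 2 x : DLoRA.Mat r k)‖ ^ 2 = ∑ i, x i ^ 2 := by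
    intro x
    simp [EuclideanSpace.norm_sq_eq]
  have hnn : 0 ≤ √((k : ℝ) * r) + t := by positivity
  -- The tail bound divides by the square root of the number of entries; with no entries the event
  -- is everything.
  rcases isEmpty_or_nonempty (Fin r × Fin k) with hempty | hnonempty
  · have huniv : S = Set.univ := by
      refine Set.eq_univ_of_forall fun x => ?_
      have h0 : ‖(WithLp.toLp 2 x : DLoRA.Mat r k)‖ = 0 := by
        rw [← sq_eq_zero_iff, hsq]; simp
      exact h0.trans_le hnn
    rw [huniv, probReal_univ]
    linarith [Real.exp_pos (-t ^ 2 / 2)]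
  have hcard : (Fintype.card (Fin r × Fin k) : ℝ) = (k : ℝ) * r := by simp [mul_comm]
  have htail := gaussian_norm_tail (ι := Fin r × Fin k) ht
  rw [hcard] at htail
  have hsub : Sᶜ ⊆ {x : Fin r × Fin k → ℝ | (√((k : ℝ) * r) + t) ^ 2 ≤ ∑ i, x i ^ 2} := by
    intro x hx
    have hx' : √((k : ℝ) * r) + t < ‖(WithLp.toLp 2 x : DLoRA.Mat r k)‖ := not_le.1 hx
    have : (√((k : ℝ) * r) + t) ^ 2 ≤ ‖(WithLp.toLp 2 x : DLoRA.Mat r k)‖ ^ 2 := by gcongr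
    rwa [hsq] at this
  have h1 := measureReal_mono (μ := μ) hsub
  have h2 := probReal_compl_eq_one_sub (μ := μ) (hmeas hS)
  rw [← hSdef] at h2
  linarith

end GaussianNorm

namespace DLoRA

/-! ### Smoothness and measurability in the trainable matrix -/

section Adapter

/-- Cauchy–Schwarz for each entry of the product, then summation over the entries. -/
theorem norm_matMul_le {d r k : ℕ} (B : Mat d r) (A : Mat r k) : ‖matMul B A‖ ≤ ‖B‖ * ‖A‖ := by
  refine le_of_sq_le_sq ?_ (by positivity)
  rw [mul_pow]
  simp only [EuclideanSpace.norm_sq_eq, Real.norm_eq_abs, sq_abs, matMul, Fintype.sum_prod_type]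
  rw [Finset.sum_mul]
  refine Finset.sum_le_sum fun a _ => ?_
  rw [Finset.sum_comm (f := fun l b => A.ofLp (l, b) ^ 2), Finset.mul_sum]
  exact Finset.sum_le_sum fun b _ => Finset.sum_mul_sq_le_sq_mul_sq _ _ _

/-- The linear part of the map from the trainable matrix to the model parameter. -/
noncomputable def adapterMap {d r k : ℕ} (η : ℝ) (A₀ : Mat r k) : Mat d r →L[ℝ] Mat d k :=
  LinearMap.toContinuousLinearMap
    { toFun := fun B => (η / (r : ℝ)) • matMul B A₀
      map_add' := fun B C => by
        ext p
        simp [matMul, add_mul, Finset.sum_add_distrib, mul_add]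
      map_smul' := fun c B => by
        ext p
        simp only [matMul, PiLp.smul_apply, smul_eq_mul, Finset.mul_sum, RingHom.id_apply]
        exact Finset.sum_congr rfl fun l _ => by ring }

variable {d r k : ℕ} {η : ℝ} {W₀ : Mat d k} {A₀ : Mat r k}

theorem adapted_eq (B : Mat d r) : adapted η W₀ A₀ B = W₀ + adapterMap η A₀ B := rfl

theorem norm_adapterMap_le (hη : 0 ≤ η) :
    ‖(adapterMap η A₀ : Mat d r →L[ℝ] Mat d k)‖ ≤ η / r * ‖A₀‖ := by
  refine ContinuousLinearMap.opNorm_le_bound _ (by positivity) fun B => ?_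
  change ‖(η / (r : ℝ)) • matMul B A₀‖ ≤ _
  rw [norm_smul, Real.norm_of_nonneg (by positivity), mul_assoc]
  gcongr
  rw [mul_comm]
  exact norm_matMul_le B A₀

theorem hasGradientAt_lossB {φ : Mat d k → ℝ} (hφ : Differentiable ℝ φ) (B : Mat d r) :
    HasGradientAt (lossB η W₀ A₀ φ)
      ((adapterMap η A₀).adjoint (gradient φ (adapted η W₀ A₀ B))) B := by
  rw [hasGradientAt_iff_hasFDerivAt]
  have h1 : HasFDerivAt (adapted η W₀ A₀) (adapterMap η A₀ : Mat d r →L[ℝ] Mat d k) B := by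
    simpa only [adapted_eq] using! (adapterMap η A₀).hasFDerivAt.const_add W₀
  have h2 := (hφ (adapted η W₀ A₀ B)).hasGradientAt.hasFDerivAt.comp B h1
  refine h2.congr_fderiv ?_
  ext v
  simp [ContinuousLinearMap.adjoint_inner_left]

theorem gradB_eq {φ : Mat d k → ℝ} (hφ : Differentiable ℝ φ) (B : Mat d r) :
    gradB η W₀ A₀ φ B = (adapterMap η A₀).adjoint (gradient φ (adapted η W₀ A₀ B)) :=
  (hasGradientAt_lossB hφ B).gradient

/-- The gradient is the adjoint of `adapterMap` applied to the full gradient at the adapted point,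
so the operator norm counts once in the adjoint and once in the displacement of the point. -/
theorem norm_gradB_sub_le (hη : 0 ≤ η) {φ : Mat d k → ℝ} (hφ : Differentiable ℝ φ) {L Ls : ℝ}
    (hL : 0 ≤ L) (hsmooth : ∀ W W', ‖gradient φ W - gradient φ W'‖ ≤ L * ‖W - W'‖)
    (hLs : L * (η / r * ‖A₀‖) ^ 2 ≤ Ls) (B C : Mat d r) :
    ‖gradB η W₀ A₀ φ B - gradB η W₀ A₀ φ C‖ ≤ Ls * ‖B - C‖ := by
  have hT := norm_adapterMap_le (d := d) (A₀ := A₀) hη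
  rw [gradB_eq hφ, gradB_eq hφ, ← map_sub]
  calc _ ≤ ‖(adapterMap η A₀ : Mat d r →L[ℝ] Mat d k).adjoint‖
        * ‖gradient φ (adapted η W₀ A₀ B) - gradient φ (adapted η W₀ A₀ C)‖ :=
        ContinuousLinearMap.le_opNorm _ _
    _ ≤ (η / r * ‖A₀‖) * (L * ((η / r * ‖A₀‖) * ‖B - C‖)) := by
        rw [LinearIsometryEquiv.norm_map]
        gcongr
        refine (hsmooth _ _).trans ?_
        gcongr
        rw [adapted_eq, adapted_eq, add_sub_add_left_eq_sub, ← map_sub]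
        exact (ContinuousLinearMap.le_opNorm _ _).trans (by gcongr)
    _ = L * (η / r * ‖A₀‖) ^ 2 * ‖B - C‖ := by ring
    _ ≤ Ls * ‖B - C‖ := by gcongr

/-- The chain rule transfers the joint measurability assumed for the full gradient. -/
theorem measurable_gradB_sample {X : Type*} [MeasurableSpace X] {F : Mat d k → X → ℝ}
    (hFdiff : ∀ x, Differentiable ℝ (fun W => F W x))
    (hFmeas : Measurable (fun p : Mat d k × X => gradient (fun W => F W p.2) p.1)) :
    Measurable fun p : Mat d r × X => gradB η W₀ A₀ (fun W => F W p.2) p.1 := by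
  have h : (fun p : Mat d r × X => gradB η W₀ A₀ (fun W => F W p.2) p.1)
      = fun p => (adapterMap η A₀).adjoint
        (gradient (fun W => F W p.2) (W₀ + adapterMap η A₀ p.1)) := by
    funext p
    exact gradB_eq (hFdiff p.2) p.1
  rw [h]
  refine (ContinuousLinearMap.measurable _).comp (hFmeas.comp (Measurable.prodMk ?_ measurable_snd))
  exact ((adapterMap η A₀).measurable.comp measurable_fst).const_add W₀

theorem measurable_stochGrad {m : ℕ} {X : Type*} [MeasurableSpace X] {F : Mat d k → X → ℝ}
    (hFdiff : ∀ x, Differentiable ℝ (fun W => F W x))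
    (hFmeas : Measurable (fun p : Mat d k × X => gradient (fun W => F W p.2) p.1)) :
    Measurable fun p : Mat d r × (Fin m → X) => stochGrad η W₀ A₀ F p.2 p.1 := by
  have h : ∀ s, Measurable fun p : Mat d r × (Fin m → X) => (p.1, p.2 s) := fun s =>
    measurable_fst.prodMk ((measurable_pi_apply s).comp measurable_snd)
  have hsum : Measurable fun p : Mat d r × (Fin m → X) =>
      ∑ s, gradB η W₀ A₀ (fun W => F W (p.2 s)) p.1 :=
    Finset.measurable_fun_sum _ fun s _ => (measurable_gradB_sample hFdiff hFmeas).comp (h s)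
  exact hsum.const_smul (m : ℝ)⁻¹

end Adapter

/-! ### Mini-batch averages and independence from the past -/

section Batch

/-- Averaging centred samples over a mini-batch keeps the mean and the variance bound. -/
theorem batch_mean_noise {Ω X V : Type*} [MeasurableSpace Ω] {P : Measure Ω}
    [MeasurableSpace X] {𝒟 : Measure X} [IsProbabilityMeasure 𝒟]
    [NormedAddCommGroup V] [InnerProductSpace ℝ V] [CompleteSpace V] {m : ℕ} (hm : 0 < m)
    {q : X → V} (hq : MemLp q 2 𝒟) (hmean : ∫ x, q x ∂𝒟 = 0) {c : ℝ}
    (hvar : ∫ x, ‖q x‖ ^ 2 ∂𝒟 ≤ c) {ξ : Ω → Fin m → X} (hξ : Measurable ξ)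
    (hlaw : ∀ s, P.map (fun ω => ξ ω s) = 𝒟) :
    MemLp (fun ω => vmean fun s => q (ξ ω s)) 2 P ∧
    ∫ ω, vmean (fun s => q (ξ ω s)) ∂P = 0 ∧
    ∫ ω, ‖vmean fun s => q (ξ ω s)‖ ^ 2 ∂P ≤ c := by
  have hξs : ∀ s, AEMeasurable (fun ω => ξ ω s) P := fun s =>
    ((measurable_pi_apply s).comp hξ).aemeasurable
  have hqs : ∀ s, MemLp (fun ω => q (ξ ω s)) 2 P := fun s => by
    rw [← hlaw s] at hq
    exact (memLp_map_measure_iff hq.1 (hξs s)).1 hq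
  have hI1 : ∀ s, Integrable (fun ω => q (ξ ω s)) P := fun s => by
    have h : Integrable q 𝒟 := hq.integrable one_le_two
    rw [← hlaw s] at h
    exact (integrable_map_measure h.1 (hξs s)).1 h
  have hms : ∀ s, ∫ ω, q (ξ ω s) ∂P = 0 := fun s => by
    rw [← hmean, ← hlaw s, integral_map (hξs s) (by rw [hlaw s]; exact hq.1)]
  have hvs : ∀ s, ∫ ω, ‖q (ξ ω s)‖ ^ 2 ∂P ≤ c := fun s => by
    refine le_trans (le_of_eq ?_) hvar
    rw [← hlaw s, integral_map (hξs s) (by rw [hlaw s]; exact hq.integrable_norm_sq.1)]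
  have hw : MemLp (fun ω => vmean fun s => q (ξ ω s)) 2 P := MemLp.vmean hqs
  refine ⟨hw, ?_, ?_⟩
  · simp only [vmean]
    rw [integral_smul, integral_finsetSum _ fun s _ => hI1 s]
    simp [hms]
  -- Convexity suffices: samples within one batch may be dependent, so no gain by a factor `m` is
  -- available.
  · have h := integral_mono hw.integrable_norm_sq
      ((integrable_finsetSum Finset.univ fun s _ => (hqs s).integrable_norm_sq).const_mul
        (m : ℝ)⁻¹) fun ω => norm_vmean_sq_le hm fun s => q (ξ ω s)
    refine h.trans ?_
    rw [integral_const_mul, integral_finsetSum _ fun s _ => (hqs s).integrable_norm_sq,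
      inv_mul_le_iff₀ (by positivity)]
    calc _ ≤ ∑ _s : Fin m, c := Finset.sum_le_sum fun s _ => hvs s
      _ = m * c := by simp

/-- A function of the variables indexed by `S` is independent of a variable outside `S`. -/
theorem indepFun_of_measurable_iSup {Ω ι E : Type*} {β : ι → Type*} [MeasurableSpace Ω]
    {P : Measure Ω} [∀ p, MeasurableSpace (β p)] [MeasurableSpace E] {ξ : ∀ p, Ω → β p}
    (hξ : ∀ p, Measurable (ξ p)) (hind : iIndepFun ξ P) {S : Set ι} {p₀ : ι} (hp₀ : p₀ ∉ S)
    {U : Ω → E}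
    (hU : Measurable[⨆ p ∈ S, MeasurableSpace.comap (ξ p) inferInstance] U) :
    IndepFun U (ξ p₀) P := by
  have h := indep_iSup_of_disjoint (fun p => (hξ p).comap_le) hind.iIndep
    (Set.disjoint_singleton_right.2 hp₀)
  rw [IndepFun_iff_Indep]
  simp only [Set.mem_singleton_iff, iSup_iSup_eq_left] at h
  exact indep_of_indep_of_le_left h hU.comap_le

end Batch

/-! ### The recursion and measurability of its iterates -/

section Iterates

variable {d r k N : ℕ} {m : Fin N → ℕ} {X : Fin N → Type*} {η α : ℝ} {W₀ : Mat d k} {A₀ : Mat r k}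
  {F : ∀ i, Mat d k → X i → ℝ} {G : SimpleGraph (Fin N)} {M : Matrix (Fin N) (Fin N) ℝ} {ρ : ℝ}
  {B₁ : Fin N → Mat d r}

/-- Entries of `M` outside closed neighbourhoods vanish, so the neighbourhood sum may run over all
agents. -/
theorem iterate_succ (hM : IsMixingMatrix G M ρ) (batch : ℕ → ∀ i, Fin (m i) → X i) (n : ℕ)
    (i : Fin N) :
    iterate η α W₀ A₀ F G M B₁ batch (n + 1) i
      = (∑ j, M i j • iterate η α W₀ A₀ F G M B₁ batch n j)
        - α • stochGrad η W₀ A₀ (F i) (batch n i)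
            (iterate η α W₀ A₀ F G M B₁ batch n i) := by
  simp only [iterate, Finset.sum_filter]
  congr 1
  refine Finset.sum_congr rfl fun j _ => ?_
  split_ifs with h
  · rfl
  · rw [not_or] at h
    rw [hM.support i j (Ne.symm h.1) h.2, zero_smul]

variable [∀ i, MeasurableSpace (X i)]

/-- The σ-algebra on `Ω` is left free so that it can be taken to be the one generated by the past
batches. -/
theorem measurable_iterate (hFdiff : ∀ i x, Differentiable ℝ (fun W => F i W x))
    (hFmeas : ∀ i, Measurable (fun p : Mat d k × X i => gradient (fun W => F i W p.2) p.1))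
    (hM : IsMixingMatrix G M ρ) {Ω : Type*} {mΩ : MeasurableSpace Ω}
    {batch : Ω → ℕ → ∀ i, Fin (m i) → X i} (n : ℕ)
    (hb : ∀ l, l < n → ∀ i, Measurable fun ω => batch ω l i) :
    Measurable fun ω => iterate η α W₀ A₀ F G M B₁ (batch ω) n := by
  induction n with
  | zero => exact measurable_const
  | succ n ih =>
    have h := ih fun l hl => hb l (hl.trans n.lt_succ_self)
    refine measurable_pi_lambda _ fun i => ?_
    simp_rw [iterate_succ hM]
    exact (Finset.measurable_fun_sum _ fun j _ =>
      ((measurable_pi_apply j).comp h).const_smul (M i j)).sub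
      (((measurable_stochGrad (hFdiff i) (hFmeas i)).comp
        (((measurable_pi_apply i).comp h).prodMk (hb n n.lt_succ_self i))).const_smul α)

end Iterates

/-! ### Convergence of DLoRA-FA for frozen `A₀` -/

section Convergence

variable {d k r N : ℕ} {X : Fin N → Type*} [∀ i, MeasurableSpace (X i)]
  {𝒟 : ∀ i, Measure (X i)}
  {F : ∀ i, Mat d k → X i → ℝ} {W₀ : Mat d k} {η L Ls : ℝ} {A₀ : Mat r k}
  {G : SimpleGraph (Fin N)} {M : Matrix (Fin N) (Fin N) ℝ} {ρ ζ κ : ℝ}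

theorem gradB_globalLoss (hfdiff : ∀ i, Differentiable ℝ (localLoss (𝒟 i) (F i))) (B : Mat d r) :
    gradB η W₀ A₀ (globalLoss 𝒟 F) B
      = vmean fun i => gradB η W₀ A₀ (localLoss (𝒟 i) (F i)) B := by
  have hφ : ∀ i B, HasGradientAt (lossB η W₀ A₀ (localLoss (𝒟 i) (F i)))
      (gradB η W₀ A₀ (localLoss (𝒟 i) (F i)) B) B := fun i B => by
    rw [gradB_eq (hfdiff i)]
    exact hasGradientAt_lossB (hfdiff i) B
  exact (hasGradientAt_mean hφ B).gradient

variable [∀ i, IsProbabilityMeasure (𝒟 i)]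

/-- The centred sample gradients under the assumptions for the frozen `A₀`. -/
theorem FrozenAssumptions.sample_noise
    (hFdiff : ∀ i x, Differentiable ℝ (fun W => F i W x))
    (hFmeas : ∀ i, Measurable (fun p : Mat d k × X i => gradient (fun W => F i W p.2) p.1))
    (hA : FrozenAssumptions η W₀ A₀ 𝒟 F ζ κ) (i : Fin N) (B : Mat d r) :
    MemLp (fun x => gradB η W₀ A₀ (fun W => F i W x) B
      - gradB η W₀ A₀ (localLoss (𝒟 i) (F i)) B) 2 (𝒟 i) ∧
    ∫ x, (gradB η W₀ A₀ (fun W => F i W x) B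
      - gradB η W₀ A₀ (localLoss (𝒟 i) (F i)) B) ∂𝒟 i = 0 := by
  have hmeas : Measurable fun x => gradB η W₀ A₀ (fun W => F i W x) B :=
    (measurable_gradB_sample (hFdiff i) (hFmeas i)).comp measurable_prodMk_left
  have hL2 : MemLp (fun x => gradB η W₀ A₀ (fun W => F i W x) B
      - gradB η W₀ A₀ (localLoss (𝒟 i) (F i)) B) 2 (𝒟 i) :=
    (memLp_two_iff_integrable_sq_norm (hmeas.sub_const _).aestronglyMeasurable).2
      (hA.integrable_variance i B)
  refine ⟨hL2, ?_⟩
  have hI : Integrable (fun x => gradB η W₀ A₀ (fun W => F i W x) B) (𝒟 i) := by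
    simpa [Pi.add_def] using (hL2.integrable one_le_two).add
      (integrable_const (gradB η W₀ A₀ (localLoss (𝒟 i) (F i)) B))
  rw [integral_sub hI (integrable_const _), hA.unbiased i B]
  simp

/-- The deviation of the mini-batch gradient from the gradient of the local loss. -/
noncomputable def batchNoise {X : Type*} [MeasurableSpace X] {m : ℕ} (η : ℝ) (W₀ : Mat d k)
    (A₀ : Mat r k) (μ : Measure X) (F : Mat d k → X → ℝ) (B : Mat d r) (b : Fin m → X) :
    Mat d r :=
  stochGrad η W₀ A₀ F b B - gradB η W₀ A₀ (localLoss μ F) B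

theorem measurable_batchNoise {X : Type*} [MeasurableSpace X] {m : ℕ} {μ : Measure X}
    {F : Mat d k → X → ℝ} (hFdiff : ∀ x, Differentiable ℝ (fun W => F W x))
    (hFmeas : Measurable (fun p : Mat d k × X => gradient (fun W => F W p.2) p.1))
    (hg : Measurable (gradB (r := r) η W₀ A₀ (localLoss μ F))) :
    Measurable fun z : Mat d r × (Fin m → X) => batchNoise η W₀ A₀ μ F z.1 z.2 :=
  (measurable_stochGrad hFdiff hFmeas).sub (hg.comp measurable_fst)

/-- The matrix `B` is deterministic here; these are the moments with frozen state that `noise_memLp`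
and `noise_orthogonal` require. -/
theorem FrozenAssumptions.batchNoise_moments
    (hFdiff : ∀ i x, Differentiable ℝ (fun W => F i W x))
    (hFmeas : ∀ i, Measurable (fun p : Mat d k × X i => gradient (fun W => F i W p.2) p.1))
    (hA : FrozenAssumptions η W₀ A₀ 𝒟 F ζ κ) {Ω : Type*} [MeasurableSpace Ω] {P : Measure Ω}
    (i : Fin N) {m : ℕ} (hm : 0 < m) {ξ : Ω → Fin m → X i} (hξ : Measurable ξ)
    (hlaw : ∀ s, P.map (fun ω => ξ ω s) = 𝒟 i) (B : Mat d r) :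
    MemLp (fun ω => batchNoise η W₀ A₀ (𝒟 i) (F i) B (ξ ω)) 2 P ∧
      ∫ ω, batchNoise η W₀ A₀ (𝒟 i) (F i) B (ξ ω) ∂P = 0 ∧
      ∫ ω, ‖batchNoise η W₀ A₀ (𝒟 i) (F i) B (ξ ω)‖ ^ 2 ∂P ≤ ζ ^ 2 := by
  obtain ⟨h1, h2⟩ := hA.sample_noise hFdiff hFmeas i B
  have h3 := batch_mean_noise hm h1 h2 (hA.variance i B) hξ hlaw
  have h4 : ∀ b : Fin m → X i, batchNoise η W₀ A₀ (𝒟 i) (F i) B b = vmean fun s =>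
      gradB η W₀ A₀ (fun W => F i W (b s)) B - gradB η W₀ A₀ (localLoss (𝒟 i) (F i)) B := by
    intro b
    have hmi : (m : ℝ) ≠ 0 := by exact_mod_cast hm.ne'
    simp only [batchNoise, stochGrad, vmean, Finset.sum_sub_distrib, smul_sub, Finset.sum_const,
      Finset.card_univ, Fintype.card_fin, ← Nat.cast_smul_eq_nsmul ℝ, inv_smul_smul₀ hmi]
  simp_rw [h4]
  exact h3

/-- DLoRA-FA converges with every smoothness constant that dominates the one of the adapted
losses. -/
theorem convergesWith_of_smoothness (hN : 0 < N)
    (hFdiff : ∀ i x, Differentiable ℝ (fun W => F i W x))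
    (hFmeas : ∀ i, Measurable (fun p : Mat d k × X i => gradient (fun W => F i W p.2) p.1))
    (hη : 0 ≤ η) (hL : 0 ≤ L)
    (hfdiff : ∀ i, Differentiable ℝ (localLoss (𝒟 i) (F i)))
    (hsmooth : ∀ i W W', ‖gradient (localLoss (𝒟 i) (F i)) W
      - gradient (localLoss (𝒟 i) (F i)) W'‖ ≤ L * ‖W - W'‖)
    (hρ0 : 0 < ρ) (hρ1 : ρ < 1) (hM : IsMixingMatrix G M ρ)
    {m : Fin N → ℕ} (hm : ∀ i, 0 < m i)
    {Ω : Type*} [MeasurableSpace Ω] {P : Measure Ω} [IsProbabilityMeasure P]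
    {batch : Ω → ℕ → ∀ i, Fin (m i) → X i}
    (hbmeas : ∀ n i, Measurable (fun ω => batch ω n i))
    (hbindep : iIndepFun (fun (p : ℕ × Fin N) (ω : Ω) => batch ω p.1 p.2) P)
    (hblaw : ∀ n i s, P.map (fun ω => batch ω n i s) = 𝒟 i)
    (hLs0 : 0 < Ls) (hLs : L * (η / r * ‖A₀‖) ^ 2 ≤ Ls) :
    ConvergesWith P η W₀ 𝒟 F G M ρ batch A₀ Ls := by
  intro ζ κ hζ hκ hA α hα hαle B₁
  set s := √ρ with hs
  have hs0 : 0 < s := Real.sqrt_pos.2 hρ0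
  have hs1 : s < 1 := by rw [hs, Real.sqrt_lt' one_pos]; simpa using hρ1
  have hs2 : s ^ 2 = ρ := Real.sq_sqrt hρ0.le
  have h1s : 0 < 1 - s := by linarith
  -- From `√2 ≥ 7 / 5`, since `4 * (7 / 5) = 28 / 5`.
  have hαLs : α * Ls ≤ 5 / 28 * (1 - s) := by
    have h2 : (7 / 5 : ℝ) ≤ √2 := Real.le_sqrt_of_sq_le (by norm_num)
    rw [le_div_iff₀ (by positivity)] at hαle
    have h3 := mul_le_mul_of_nonneg_left h2 (mul_pos hα hLs0).le
    linarith
  set g : Fin N → Mat d r → Mat d r := fun i => gradB η W₀ A₀ (localLoss (𝒟 i) (F i)) with hg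
  set x : ℕ → Ω → Fin N → Mat d r := fun n ω => iterate η α W₀ A₀ F G M B₁ (batch ω) n with hx
  set e : ℕ → Ω → Fin N → Mat d r := fun n ω i =>
    batchNoise η W₀ A₀ (𝒟 i) (F i) (x n ω i) (batch ω n i) with he
  have hgL : ∀ i B C, ‖g i B - g i C‖ ≤ Ls * ‖B - C‖ := fun i =>
    norm_gradB_sub_le hη (hfdiff i) hL (hsmooth i) hLs
  have hgm : ∀ i, Measurable (g i) := fun i => (continuous_of_norm_sub_le (hgL i)).measurable
  have hφ : ∀ i B, HasGradientAt (lossB η W₀ A₀ (localLoss (𝒟 i) (F i))) (g i B) B := fun i B => by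
    simp only [hg, gradB_eq (hfdiff i)]
    exact hasGradientAt_lossB (hfdiff i) B
  have hglobal : ∀ B, gradB η W₀ A₀ (globalLoss 𝒟 F) B = vmean fun i => g i B :=
    gradB_globalLoss hfdiff
  have hh : ∀ i, Measurable fun z : Mat d r × (Fin (m i) → X i) =>
      batchNoise η W₀ A₀ (𝒟 i) (F i) z.1 z.2 := fun i =>
    measurable_batchNoise (hFdiff i) (hFmeas i) (hgm i)
  have hstate : ∀ n i B, MemLp (fun ω => batchNoise η W₀ A₀ (𝒟 i) (F i) B (batch ω n i)) 2 P ∧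
      ∫ ω, batchNoise η W₀ A₀ (𝒟 i) (F i) B (batch ω n i) ∂P = 0 ∧
      ∫ ω, ‖batchNoise η W₀ A₀ (𝒟 i) (F i) B (batch ω n i)‖ ^ 2 ∂P ≤ ζ ^ 2 := fun n i B =>
    hA.batchNoise_moments hFdiff hFmeas i (hm i) (hbmeas n i) (hblaw n i) B
  have hxm : ∀ n, Measurable (x n) := fun n =>
    measurable_iterate hFdiff hFmeas hM n fun l _ i => hbmeas l i
  have hbm : ∀ p : ℕ × Fin N, Measurable fun ω => batch ω p.1 p.2 := fun p => hbmeas p.1 p.2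
  let past : Set (ℕ × Fin N) → MeasurableSpace Ω := fun S =>
    ⨆ p ∈ S, MeasurableSpace.comap (fun ω => batch ω p.1 p.2) inferInstance
  have hbpast : ∀ (S : Set (ℕ × Fin N)) p, p ∈ S →
      Measurable[past S] fun ω => batch ω p.1 p.2 := fun S p hp =>
    Measurable.of_comap_le (le_iSup₂_of_le p hp le_rfl)
  have hxpast : ∀ (S : Set (ℕ × Fin N)) n, (∀ p : ℕ × Fin N, p.1 < n → p ∈ S) →
      Measurable[past S] (x n) := fun S n hS =>
    @measurable_iterate d r k N m X η α W₀ A₀ F G M ρ B₁ _ hFdiff hFmeas hM Ω (past S) batch n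
      fun l hl i => hbpast S (l, i) (hS (l, i) hl)
  have hind1 : ∀ n i, IndepFun (x n) (fun ω => batch ω n i) P := fun n i =>
    indepFun_of_measurable_iSup (p₀ := (n, i)) (S := {p | p.1 < n}) hbm hbindep
      (by simp) (hxpast _ n fun p hp => hp)
  have hind2 : ∀ n i j, i ≠ j →
      IndepFun (fun ω => (x n ω, batch ω n j)) (fun ω => batch ω n i) P := by
    intro n i j hij
    have hU := (hxpast {p | p.1 < n ∨ p = (n, j)} n fun p hp => Or.inl hp).prodMk
      (hbpast {p | p.1 < n ∨ p = (n, j)} (n, j) (Or.inr rfl))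
    exact indepFun_of_measurable_iSup (p₀ := (n, i)) hbm hbindep (by simp [hij]) hU
  have hxim : ∀ n i, Measurable fun ω => x n ω i := fun n i =>
    (measurable_pi_apply i).comp (hxm n)
  have hnoise : ∀ n i, MemLp (fun ω => e n ω i) 2 P ∧ ∫ ω, ‖e n ω i‖ ^ 2 ∂P ≤ ζ ^ 2 := fun n i =>
    noise_memLp (hxim n i) (hbmeas n i)
      ((hind1 n i).comp (measurable_pi_apply i) measurable_id) (hh i) (sq_nonneg ζ)
      (fun B => (hstate n i B).1.integrable_norm_sq) fun B => (hstate n i B).2.2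
  have horth : ∀ n i (ψ : (Fin N → Mat d r) → Mat d r), Measurable ψ →
      MemLp (fun ω => ψ (x n ω)) 2 P → ∫ ω, inner ℝ (ψ (x n ω)) (e n ω i) ∂P = 0 := by
    intro n i ψ hψ hψL
    have hm1 : Measurable fun z : (Fin N → Mat d r) × (Fin (m i) → X i) => (z.1 i, z.2) :=
      ((measurable_pi_apply i).comp measurable_fst).prodMk measurable_snd
    exact noise_orthogonal (hxm n) (hbmeas n i) (hind1 n i) ((hh i).comp hm1)
      (fun u => (hstate n i (u i)).1.integrable one_le_two) (fun u => (hstate n i (u i)).2.1)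
      (hnoise n i).1 hψ hψL
  have hcross : ∀ n i j, i ≠ j → ∫ ω, inner ℝ (e n ω i) (e n ω j) ∂P = 0 := by
    intro n i j hij
    have hm1 : Measurable fun z : ((Fin N → Mat d r) × (Fin (m i) → X i)) × (Fin (m j) → X j) =>
        (z.1.1 j, z.2) :=
      ((measurable_pi_apply j).comp (measurable_fst.comp measurable_fst)).prodMk measurable_snd
    have hm2 : Measurable fun z : (Fin N → Mat d r) × (Fin (m i) → X i) => (z.1 i, z.2) :=
      ((measurable_pi_apply i).comp measurable_fst).prodMk measurable_snd
    -- The batch of agent `i` is adjoined to the state, so its noise becomes a function of that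
    -- enlarged state, independent of the batch of agent `j`.
    exact noise_orthogonal (U := fun ω => (x n ω, batch ω n i)) (ξ := fun ω => batch ω n j)
      ((hxm n).prodMk (hbmeas n i)) (hbmeas n j) (hind2 n j i hij.symm) ((hh j).comp hm1)
      (fun u => (hstate n j (u.1 j)).1.integrable one_le_two)
      (fun u => (hstate n j (u.1 j)).2.1) (hnoise n j).1 ((hh i).comp hm2) (hnoise n i).1
  have hc : ∀ B, (⨅ B : Mat d r, lossB η W₀ A₀ (globalLoss 𝒟 F) B)
      ≤ (N : ℝ)⁻¹ * ∑ i, lossB η W₀ A₀ (localLoss (𝒟 i) (F i)) B := fun B =>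
    ciInf_le hA.bddBelow B
  have hdiv : ∀ B, (N : ℝ)⁻¹ * ∑ i, ‖g i B - vmean fun i => g i B‖ ^ 2 ≤ κ ^ 2 := fun B => by
    rw [← hglobal]
    exact hA.diversity B
  obtain ⟨hint, hsum⟩ := decentralized_sgd_bound (P := P) (B := B₁) (x := x)
    (e := e) hN hLs0 hφ hgL hc hdiv
    (sum_row_of_mem_doublyStochastic hM.doublyStochastic)
    (sum_col_of_mem_doublyStochastic hM.doublyStochastic) hs0 hs1
    (fun Y hY => by rw [hs2]; exact hM.sum_norm_sq_le hN hρ0.le hρ1 Y hY) hα hαLs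
    (fun _ => rfl)
    (fun n ω i => by
      simp only [hx, he, hg, batchNoise, iterate_succ hM, add_sub_cancel])
    (fun n i => (hnoise n i).1) (fun n i => (hnoise n i).2) horth hcross
  have havg : ∀ n ω, gradB η W₀ A₀ (globalLoss 𝒟 F)
      (average (iterate η α W₀ A₀ F G M B₁ (batch ω) n)) = vmean fun i => g i (vmean (x n ω)) :=
    fun n ω => hglobal _
  simp_rw [havg]
  refine ⟨hint, fun T hT => ?_⟩
  have hTpos : (0 : ℝ) < T := by exact_mod_cast hT
  have hNpos : (0 : ℝ) < N := by exact_mod_cast hN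
  rw [inv_mul_le_iff₀ hTpos]
  refine (hsum T).trans ?_
  rw [hs2]
  have hρs : 0 < 1 - ρ := by linarith
  -- Since `ρ = s ^ 2 ≤ s`, the left side is at most `(3 / 2) * 9 / (1 - s) ^ 2`, and `27 / 2 ≤ 16`.
  have e1 : 3 / 2 / (1 - ρ) * (1 + 8 / (1 - s)) ≤ 16 / (1 - s) ^ 2 := by
    have h1 : 1 + 8 / (1 - s) ≤ 9 / (1 - s) := by
      rw [← sub_nonneg]
      have : 9 / (1 - s) - (1 + 8 / (1 - s)) = s / (1 - s) := by field_simp; ring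
      rw [this]
      positivity
    have h2 : 1 - s ≤ 1 - ρ := by rw [← hs2]; nlinarith
    calc 3 / 2 / (1 - ρ) * (1 + 8 / (1 - s)) ≤ 3 / 2 / (1 - s) * (9 / (1 - s)) := by gcongr
      _ = 27 / 2 / (1 - s) ^ 2 := by field_simp; ring
      _ ≤ 16 / (1 - s) ^ 2 := by gcongr; norm_num
  have e2 : 3 / 2 / (1 - ρ) ≤ 4 / (1 - ρ) := by gcongr; norm_num
  have e3 := mul_le_mul_of_nonneg_right e1 (by positivity : 0 ≤ (α * Ls) ^ 2 * κ ^ 2)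
  have e4 := mul_le_mul_of_nonneg_right e2 (by positivity : 0 ≤ (α * Ls) ^ 2 * ζ ^ 2)
  have e5 := mul_le_mul_of_nonneg_left (add_le_add e3 e4) hTpos.le
  have e6 : (T : ℝ) * (2 * (lossB η W₀ A₀ (globalLoss 𝒟 F) (average B₁)
              - ⨅ B : Mat d r, lossB η W₀ A₀ (globalLoss 𝒟 F) B) / (α * T)
          + Ls * α * ζ ^ 2 / N
          + Ls ^ 2 * (∑ i, ‖B₁ i‖ ^ 2) / (T * N * (1 - ρ))
          + 16 * α ^ 2 * κ ^ 2 * Ls ^ 2 / (1 - s) ^ 2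
          + 4 * α ^ 2 * ζ ^ 2 * Ls ^ 2 / (1 - ρ))
      = 2 / α * (lossB η W₀ A₀ (globalLoss 𝒟 F) (average B₁)
              - ⨅ B : Mat d r, lossB η W₀ A₀ (globalLoss 𝒟 F) B)
        + Ls ^ 2 / N * (∑ i, ‖B₁ i‖ ^ 2) / (1 - ρ) + T * (α * Ls * ζ ^ 2 / N)
        + T * (16 / (1 - s) ^ 2 * ((α * Ls) ^ 2 * κ ^ 2)
          + 4 / (1 - ρ) * ((α * Ls) ^ 2 * ζ ^ 2)) := by
    field_simp
    ring
  rw [e6]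
  have e7 : (N : ℝ)⁻¹ * ∑ i, lossB η W₀ A₀ (localLoss (𝒟 i) (F i)) (vmean B₁)
      = lossB η W₀ A₀ (globalLoss 𝒟 F) (average B₁) := rfl
  rw [e7]
  linarith

end Convergence

end DLoRA

/-! ### The two smoothness constants and the final assembly -/

theorem DLoRA.smoothness_const_eq {k r : ℕ} (hr : 0 < r) (η L : ℝ) :
    L * (η / r) ^ 2 * ((r : ℝ) ^ 2 + k * r + 2 * √((k : ℝ) * r))
      = η ^ 2 * L * (1 + (k : ℝ) / r + 2 * (√(k : ℝ) / (r : ℝ) ^ (3 / 2 : ℝ))) := by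
  have hr0 : (0 : ℝ) < r := by exact_mod_cast hr
  have hs : 0 < √(r : ℝ) := Real.sqrt_pos.2 hr0
  have h1 : (r : ℝ) ^ (3 / 2 : ℝ) = r * √r := by
    rw [show (3 / 2 : ℝ) = 1 + 1 / 2 by norm_num, Real.rpow_add hr0, Real.rpow_one,
      Real.sqrt_eq_rpow]
  rw [h1, Real.sqrt_mul (Nat.cast_nonneg k)]
  field_simp
  linear_combination L * η ^ 2 * 2 * √(k : ℝ) * Real.sq_sqrt hr0.le

theorem DLoRA.smoothness_const_eq' {k r : ℕ} (hr : 0 < r) (η L : ℝ) :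
    L * (η / r) ^ 2 * ((r : ℝ) + √((k : ℝ) * r)) ^ 2
      = η ^ 2 * L * (1 + (k : ℝ) / r + 2 * √((k : ℝ) / r)) := by
  have hr0 : (0 : ℝ) < r := by exact_mod_cast hr
  have h1 : √((k : ℝ) * r) = r * √((k : ℝ) / r) := by
    rw [show (k : ℝ) * r = (r : ℝ) ^ 2 * ((k : ℝ) / r) by field_simp,
      Real.sqrt_mul (sq_nonneg _), Real.sqrt_sq hr0.le]
  have h2 : √((k : ℝ) / r) ^ 2 = (k : ℝ) / r := Real.sq_sqrt (by positivity)
  rw [h1]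
  generalize √((k : ℝ) / r) = y at h2 ⊢
  rw [← h2]
  field_simp
  ring

theorem mainTheorem6 {d k r N : ℕ} (hr : 0 < r) (hN : 0 < N)
    -- data distributions, sample losses, frozen pre-trained weights
    {X : Fin N → Type*} [∀ i, MeasurableSpace (X i)]
    (𝒟 : ∀ i, Measure (X i)) [∀ i, IsProbabilityMeasure (𝒟 i)]
    (F : ∀ i, DLoRA.Mat d k → X i → ℝ) (W₀ : DLoRA.Mat d k)
    (hFint : ∀ i W, Integrable (F i W) (𝒟 i))
    (hFdiff : ∀ i x, Differentiable ℝ (fun W => F i W x))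
    (hFmeas : ∀ i, Measurable
      (fun p : DLoRA.Mat d k × X i => gradient (fun W => F i W p.2) p.1))
    -- smoothness of the local losses in the full parameter
    (η L : ℝ) (hη : 0 < η) (hL : 0 < L)
    (hfdiff : ∀ i, Differentiable ℝ (DLoRA.localLoss (𝒟 i) (F i)))
    (hsmooth : ∀ i W W', ‖gradient (DLoRA.localLoss (𝒟 i) (F i)) W
      - gradient (DLoRA.localLoss (𝒟 i) (F i)) W'‖ ≤ L * ‖W - W'‖)
    -- communication graph and mixing matrix
    (G : SimpleGraph (Fin N)) (M : Matrix (Fin N) (Fin N) ℝ) (ρ : ℝ) (hρ0 : 0 < ρ) (hρ1 : ρ < 1)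
    (hM : DLoRA.IsMixingMatrix G M ρ)
    -- mini-batches: independent over rounds and agents, every sample distributed as `𝒟 i`
    (m : Fin N → ℕ) (hm : ∀ i, 0 < m i)
    {Ω : Type*} [MeasurableSpace Ω] (P : Measure Ω) [IsProbabilityMeasure P]
    (batch : Ω → ℕ → ∀ i, Fin (m i) → X i)
    (hbmeas : ∀ n i, Measurable (fun ω => batch ω n i))
    (hbindep : iIndepFun (fun (p : ℕ × Fin N) (ω : Ω) => batch ω p.1 p.2) P)
    (hblaw : ∀ n i s, P.map (fun ω => batch ω n i s) = 𝒟 i) :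
    -- the smoothness constant of the theorem
    ((∀ A₀ : DLoRA.Mat r k, ‖A₀‖ ^ 2 ≤ (r : ℝ) ^ 2 + k * r + 2 * √((k : ℝ) * r) →
        DLoRA.ConvergesWith P η W₀ 𝒟 F G M ρ batch A₀
          (η ^ 2 * L * (1 + (k : ℝ) / r + 2 * (√(k : ℝ) / (r : ℝ) ^ (3 / 2 : ℝ))))) ∧
      1 - Real.exp (-(√((r : ℝ) ^ 2 + k * r + 2 * √((k : ℝ) * r)) - √((k : ℝ) * r)) ^ 2 / 2)
        ≤ (DLoRA.gaussianMatrix r k).real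
            {A₀ | ‖A₀‖ ^ 2 ≤ (r : ℝ) ^ 2 + k * r + 2 * √((k : ℝ) * r)}) ∧
    -- the smoothness constant that the bound `r + √(k r)` on the Frobenius norm yields
    ((∀ A₀ : DLoRA.Mat r k, ‖A₀‖ ≤ (r : ℝ) + √((k : ℝ) * r) →
        DLoRA.ConvergesWith P η W₀ 𝒟 F G M ρ batch A₀
          (η ^ 2 * L * (1 + (k : ℝ) / r + 2 * √((k : ℝ) / r)))) ∧
      1 - Real.exp (-(r : ℝ) ^ 2 / 2)
        ≤ (DLoRA.gaussianMatrix r k).real {A₀ | ‖A₀‖ ≤ (r : ℝ) + √((k : ℝ) * r)}) := by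
  have hr0 : (0 : ℝ) < r := by exact_mod_cast hr
  refine ⟨⟨fun A₀ hA => ?_, ?_⟩, ⟨fun A₀ hA => ?_, ?_⟩⟩
  · refine DLoRA.convergesWith_of_smoothness hN hFdiff hFmeas hη.le hL.le hfdiff hsmooth hρ0 hρ1 hM
      hm hbmeas hbindep hblaw (by positivity) ?_
    rw [← DLoRA.smoothness_const_eq hr, mul_pow, ← mul_assoc]
    gcongr
  · have hq : √((k : ℝ) * r) ≤ √((r : ℝ) ^ 2 + k * r + 2 * √((k : ℝ) * r)) :=
      Real.sqrt_le_sqrt (by nlinarith [Real.sqrt_nonneg ((k : ℝ) * r), sq_nonneg (r : ℝ)])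
    -- Here `t` is the gap between the threshold for `‖A₀‖` and `√(k r)`; for the second constant
    -- this gap is exactly `r`.
    have h := DLoRA.gaussianMatrix_norm_le r k (sub_nonneg.2 hq)
    have hset : {A₀ : DLoRA.Mat r k | ‖A₀‖ ^ 2 ≤ (r : ℝ) ^ 2 + k * r + 2 * √((k : ℝ) * r)}
        = {A₀ | ‖A₀‖ ≤ √((k : ℝ) * r)
          + (√((r : ℝ) ^ 2 + k * r + 2 * √((k : ℝ) * r)) - √((k : ℝ) * r))} := by
      ext A₀
      rw [Set.mem_ofPred_eq, Set.mem_ofPred_eq, add_sub_cancel,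
        Real.le_sqrt (norm_nonneg _) (by positivity)]
    rw [hset]
    exact h
  · refine DLoRA.convergesWith_of_smoothness hN hFdiff hFmeas hη.le hL.le hfdiff hsmooth hρ0 hρ1 hM
      hm hbmeas hbindep hblaw (by positivity) ?_
    rw [← DLoRA.smoothness_const_eq' hr, mul_pow, ← mul_assoc]
    gcongr
  · simpa only [add_comm (r : ℝ)] using DLoRA.gaussianMatrix_norm_le r k hr0.le
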